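/- Let $\Delta=\{z\in\mathbb C:|z|<1\}$, let $\Delta^*=\{z:|z|>1\}\cup\{\infty\}$, and let $s>0$ be non-integral. A function on $S^1$ is in $C^s$ if, as a function of the angle, it is $\lfloor s\rfloor$ times continuously differentiable and its derivative of order $\lfloor s\rfloor$ is Hölder continuous with exponent $s-\lfloor s\rfloor$; a loop is in $C^s(S^1,SL(2,\mathbb C))$ if its entries are in $C^s$. A holomorphic function on $\Delta$ or $\Delta^*$ has $C^s$ boundary values if it extends continuously to $S^1$ and its restriction to $S^1$ is in $C^s$. A triangular factorization of a loop $g$ with factors having $C^s$ boundary values is an identity $$g(z)=l(z)\begin{pmatrix}\mathbf a&0\\0&\mathbf a^{-1}\end{pmatrix}u(z),\qquad z\in S^1,$$ where $\mathbf a\in\mathbb C\setminus\{0\}$, $l:\Delta^*\to SL(2,\mathbb C)$ and $u:\Delta\to SL(2,\mathbb C)$ are holomorphic with $C^s$ boundary values, $l(\infty)$ is unipotent lower triangular, and $u(0)$ is unipotent upper triangular. **First part.** Let $g_1\in C^s(S^1,SL(2,\mathbb C))$. The following are equivalent. (I.1) $g_1$ is of the form $$g_1(z)=\begin{pmatrix}a_1(z)&b_1(z)\\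 \tilde c_1(z)&\tilde d_1(z)\end{pmatrix},\qquad z\in S^1,$$ where $a_1,b_1$ are holomorphic in $\Delta$ with $C^s$ boundary values, $a_1(0)\neq0$, and $a_1$ and $b_1$ do not vanish simultaneously at any point of $\Delta$ (no further conditions are imposed on $\tilde c_1,\tilde d_1$). (I.3) $g_1$ has a triangular factorization of the form $$g_1=\begin{pmatrix}1&0\\ \sum_{j=0}^\infty y_j^*z^{-j}&1\end{pmatrix}\begin{pmatrix}\mathbf a_1&0\\0&\mathbf a_1^{-1}\end{pmatrix}\begin{pmatrix}\alpha_1(z)&\beta_1(z)\\ \gamma_1(z)&\delta_1(z)\end{pmatrix}$$ whose factors have $C^s$ boundary values. **Second part.** Let $g_2\in C^s(S^1,SL(2,\mathbb C))$. The following are equivalent. (II.1) $g_2$ is of the form $$g_2(z)=\begin{pmatrix}\tilde a_2(z)&\tilde b_2(z)\\ c_2(z)&d_2(z)\end{pmatrix},\qquad z\in S^1,$$ where $c_2,d_2$ are holomorphic in $\Delta$ with $C^s$ boundary values, $c_2(0)=0$, $d_2(0)\neq0$, and $c_2$ and $d_2$ do not vanish simultaneously at any point of $\Delta$ (no further conditions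 are imposed on $\tilde a_2,\tilde b_2$). (II.3) $g_2$ has a triangular factorization of the form $$g_2=\begin{pmatrix}1&\sum_{j=1}^\infty x_j^*z^{-j}\\ 0&1\end{pmatrix}\begin{pmatrix}\mathbf a_2&0\\0&\mathbf a_2^{-1}\end{pmatrix}\begin{pmatrix}\alpha_2(z)&\beta_2(z)\\ \gamma_2(z)&\delta_2(z)\end{pmatrix}$$ whose factors have $C^s$ boundary values. Here $y_j^*$, $x_j^*$ are complex coefficients; the series represent the corresponding entry of the first factor for $|z|>1$, and on $S^1$ they stand for its continuous boundary values. -/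

import Mathlib

open scoped Topology

namespace SLLoop

/-- `φ ∈ C^s(S¹)` for a non-integral `s > 0`: in the angular variable `θ ↦ φ (e^{iθ})`, the function
is `⌊s⌋` times continuously differentiable, and its derivative of order `⌊s⌋` is Hölder continuous
with exponent `s - ⌊s⌋`. -/
def IsHolderCs (s : ℝ) (φ : Circle → ℂ) : Prop :=
  ContDiff ℝ (⌊s⌋₊ : ℕ) (fun θ : ℝ => φ (Circle.exp θ)) ∧
    ∃ C : NNReal, HolderWith C (Real.toNNReal (s - ⌊s⌋₊))
      (iteratedDeriv ⌊s⌋₊ (fun θ : ℝ => φ (Circle.exp θ)))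

/-- A loop in `SL(2, ℂ)` is of class `C^s` if its four entries are. -/
def IsCsLoop (s : ℝ) (g : Circle → Matrix.SpecialLinearGroup (Fin 2) ℂ) : Prop :=
  ∀ i j : Fin 2, IsHolderCs s (fun z => (g z : Matrix (Fin 2) (Fin 2) ℂ) i j)

/-- The open unit disk `Δ`. -/
def disk : Set ℂ := Metric.ball 0 1

/-- The finite part of the open unit disk `Δ*` at infinity. -/
def exterior : Set ℂ := {z : ℂ | 1 < ‖z‖}

/-- `f ∈ H⁰(Δ)` has `C^s` boundary values: `f` is holomorphic in `Δ`, continuous up to the unit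
circle, and its restriction to the unit circle is of class `C^s`. -/
def DiskCs (s : ℝ) (f : ℂ → ℂ) : Prop :=
  DiffContOnCl ℂ f disk ∧ IsHolderCs s (fun z : Circle => f z)

/-- `f ∈ H⁰(Δ*)` takes the value `c` at infinity and has `C^s` boundary values. By the removable
singularity theorem, holomorphy at `∞` amounts to the existence of the limit there. -/
def ExteriorCs (s : ℝ) (f : ℂ → ℂ) (c : ℂ) : Prop :=
  DiffContOnCl ℂ f exterior ∧ Filter.Tendsto f (Bornology.cobounded ℂ) (𝓝 c) ∧
    IsHolderCs s (fun z : Circle => f z)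

/-- `g = l · diag(a, a⁻¹) · u` is a triangular factorization whose factors have `C^s` boundary
values: `l ∈ H⁰(Δ*, SL(2, ℂ))` is unipotent lower triangular at `∞`, `a` is a nonzero constant (the
product of its phase and its modulus), `u ∈ H⁰(Δ, SL(2, ℂ))` is unipotent upper triangular at `0`,
and the factorization holds on the unit circle. -/
structure IsTriangularFactorization (s : ℝ) (g : Circle → Matrix.SpecialLinearGroup (Fin 2) ℂ)
    (l : ℂ → Matrix (Fin 2) (Fin 2) ℂ) (a : ℂ) (u : ℂ → Matrix (Fin 2) (Fin 2) ℂ) : Prop where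
  lower : ∃ c : ℂ, ∀ i j : Fin 2, ExteriorCs s (fun z => l z i j) (!![1, 0; c, 1] i j)
  lower_det : ∀ z ∈ exterior, (l z).det = 1
  diag_ne_zero : a ≠ 0
  upper : ∀ i j : Fin 2, DiskCs s (fun z => u z i j)
  upper_det : ∀ z ∈ disk, (u z).det = 1
  upper_zero : ∃ c : ℂ, u 0 = !![1, c; 0, 1]
  factor : ∀ z : Circle,
    (g z : Matrix (Fin 2) (Fin 2) ℂ) = l z * !![a, 0; 0, a⁻¹] * u z

/-- The first row of `g` consists of boundary values of functions `a, b` on the disk, with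
`a(0) ≠ 0` and no common zero; nothing is required of the second row. -/
def FirstRowCondition (s : ℝ) (g : Circle → Matrix.SpecialLinearGroup (Fin 2) ℂ) : Prop :=
  ∃ a b : ℂ → ℂ, DiskCs s a ∧ DiskCs s b ∧ a 0 ≠ 0 ∧
    (∀ z ∈ disk, ¬ (a z = 0 ∧ b z = 0)) ∧
    ∀ z : Circle, ∃ c d : ℂ, (g z : Matrix (Fin 2) (Fin 2) ℂ) = !![a z, b z; c, d]

/-- `g` has a triangular factorization with lower factor `[1, 0; ∑_{j ≥ 0} y_j z^{-j}, 1]`. -/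
def FirstFactorization (s : ℝ) (g : Circle → Matrix.SpecialLinearGroup (Fin 2) ℂ) : Prop :=
  ∃ (l u : ℂ → Matrix (Fin 2) (Fin 2) ℂ) (a : ℂ), IsTriangularFactorization s g l a u ∧
    ∃ y : ℕ → ℂ, ∀ z ∈ exterior, ∃ t : ℂ,
      HasSum (fun j : ℕ => y j * (z ^ j)⁻¹) t ∧ l z = !![1, 0; t, 1]

/-- The second row of `g` consists of boundary values of functions `c, d` on the disk, with
`c(0) = 0`, `d(0) ≠ 0` and no common zero; nothing is required of the first row. -/
def SecondRowCondition (s : ℝ) (g : Circle → Matrix.SpecialLinearGroup (Fin 2) ℂ) : Prop :=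
  ∃ c d : ℂ → ℂ, DiskCs s c ∧ DiskCs s d ∧ c 0 = 0 ∧ d 0 ≠ 0 ∧
    (∀ z ∈ disk, ¬ (c z = 0 ∧ d z = 0)) ∧
    ∀ z : Circle, ∃ a b : ℂ, (g z : Matrix (Fin 2) (Fin 2) ℂ) = !![a, b; c z, d z]

/-- `g` has a triangular factorization with lower factor `[1, ∑_{j ≥ 1} x_j z^{-j}; 0, 1]`. -/
def SecondFactorization (s : ℝ) (g : Circle → Matrix.SpecialLinearGroup (Fin 2) ℂ) : Prop :=
  ∃ (l u : ℂ → Matrix (Fin 2) (Fin 2) ℂ) (a : ℂ), IsTriangularFactorization s g l a u ∧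
    ∃ x : ℕ → ℂ, ∀ z ∈ exterior, ∃ t : ℂ,
      HasSum (fun j : ℕ => x (j + 1) * (z ^ (j + 1))⁻¹) t ∧ l z = !![1, t; 0, 1]

end SLLoop

/-! ### Periodic functions with Hölder derivatives. -/

namespace SLLoop

/-! From a factorization, the prescribed row of `l` is constant on the exterior domain, hence on the
circle by continuity. The corresponding row of `g` is therefore a constant multiple of a row of `u`,
and `det u = 1` excludes common zeros.

Conversely, let `(f, g)` be the given holomorphic row, with order and sign adjusted in the second
part, and `(φ, ψ)` the other row. The determinant excludes common zeros on the circle. If `f q - g p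
= 1` with `p, q` holomorphic on the disk, then `(φ, ψ) - (p, q)` equals `(φ q - ψ p) (f, g)` on the
circle. Splitting this multiplier as `F + H`, the disk part `F` is absorbed into `(p, q)` and the
exterior part `H` becomes the off-diagonal entry of `l`. It remains to normalize at `0`
(`exists_row_decomposition`).

Two analytic facts carry this. The Bézout identity (`exists_bezout`) comes from Gelfand theory:
characters of the disc algebra are point evaluations, so the ideal generated by `f, g` is
everything. Approximating the coefficients by polynomials and dividing by the resulting nonvanishing
function keeps the solution in `C^s`.

The splitting (`exists_disk_add_exterior`) comes from the Cauchy transform. Its derivative is `O((1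
- |z|)^(a-1))` for Hölder data of exponent `a`, so Hardy–Littlewood gives a Hölder extension to the
closed disk. Angular differentiation commutes with the transform, which gives higher regularity. The
exterior part is the transform of the reflected function at `1/z`; up to a constant the two parts
add to the Poisson integral, whose boundary value is the original function. -/

/-- `f : ℝ → ℂ` is `2π`-periodic, `k` times differentiable, and its `k`-th derivative is Hölder
continuous with exponent `a`. -/
def PerHolder (a : ℝ) : ℕ → (ℝ → ℂ) → Prop
  | 0, f => Function.Periodic f (2 * Real.pi) ∧ ∃ C : ℝ, 0 ≤ C ∧ ∀ x y, ‖f x - f y‖ ≤ C * |x - y| ^ a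
  | k + 1, f => Function.Periodic f (2 * Real.pi) ∧ Differentiable ℝ f ∧ PerHolder a k (deriv f)

namespace PerHolder

variable {a : ℝ} {k : ℕ} {f g : ℝ → ℂ}

lemma periodic (hf : PerHolder a k f) : Function.Periodic f (2 * Real.pi) := by
  cases k <;> exact hf.1

lemma bounded_of_zero (ha : 0 ≤ a) (hf : PerHolder a 0 f) : ∃ B, 0 ≤ B ∧ ∀ x, ‖f x‖ ≤ B := by
  obtain ⟨hp, C, hC, h⟩ := hf
  refine ⟨C * (2 * Real.pi) ^ a + ‖f 0‖, by positivity, fun x => ?_⟩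
  obtain ⟨y, hy, hxy⟩ := hp.exists_mem_Ico₀ (by positivity) x
  rw [hxy]
  calc ‖f y‖ = ‖(f y - f 0) + f 0‖ := by simp
    _ ≤ ‖f y - f 0‖ + ‖f 0‖ := norm_add_le _ _
    _ ≤ _ := by
      gcongr
      refine (h y 0).trans ?_
      gcongr
      rw [sub_zero, abs_of_nonneg hy.1]; exact hy.2.le

/-- The Lipschitz bound serves for `|x - y| ≤ 1`, where `|x - y| ≤ |x - y| ^ a`; at larger distances
the sup bound suffices. -/
lemma zero_of_lipschitz (ha : 0 ≤ a) (ha1 : a ≤ 1) {L B : ℝ} (hL : 0 ≤ L) (hB : 0 ≤ B)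
    (hp : Function.Periodic f (2 * Real.pi))
    (h1 : ∀ x y, ‖f x - f y‖ ≤ L * |x - y|) (h2 : ∀ x, ‖f x‖ ≤ B) : PerHolder a 0 f := by
  refine ⟨hp, L + 2 * B, by positivity, fun x y => ?_⟩
  rcases le_total |x - y| 1 with h | h
  · have := Real.rpow_le_rpow_of_exponent_ge' (abs_nonneg (x - y)) h ha ha1
    rw [Real.rpow_one] at this
    calc _ ≤ L * |x - y| := h1 x y
      _ ≤ (L + 2 * B) * |x - y| ^ a := by gcongr; linarith
  · have := Real.one_le_rpow h ha
    calc _ ≤ ‖f x‖ + ‖f y‖ := norm_sub_le _ _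
      _ ≤ (L + 2 * B) * 1 := by linarith [h2 x, h2 y]
      _ ≤ (L + 2 * B) * |x - y| ^ a := by gcongr

lemma deriv_periodic (hf : Function.Periodic f (2 * Real.pi)) :
    Function.Periodic (deriv f) (2 * Real.pi) := by
  intro x
  rw [← deriv_comp_add_const]
  congr 1
  exact funext hf

lemma bounded_periodic (hc : Continuous f) (hp : Function.Periodic f (2 * Real.pi)) :
    ∃ B, 0 ≤ B ∧ ∀ x, ‖f x‖ ≤ B := by
  obtain ⟨B, hB⟩ := (isCompact_Icc (a := (0 : ℝ)) (b := 2 * Real.pi)).exists_bound_of_continuousOn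
    hc.continuousOn
  refine ⟨max B 0, le_max_right _ _, fun x => ?_⟩
  obtain ⟨y, hy, hxy⟩ := hp.exists_mem_Ico₀ (by positivity) x
  rw [hxy]
  exact (hB y ⟨hy.1, hy.2.le⟩).trans (le_max_left _ _)

/-- A Hölder periodic derivative is bounded, so the function is Lipschitz; this settles the bottom
level. -/
lemma of_succ (ha : 0 ≤ a) (ha1 : a ≤ 1) (hf : PerHolder a (k + 1) f) : PerHolder a k f := by
  induction k generalizing f with
  | zero =>
    obtain ⟨hp, hd, hd'⟩ := hf
    obtain ⟨L, hL, hbd⟩ := hd'.bounded_of_zero ha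
    obtain ⟨B, hB, hb⟩ := bounded_periodic hd.continuous hp
    refine zero_of_lipschitz ha ha1 hL hB hp (fun x y => ?_) hb
    simpa using Convex.norm_image_sub_le_of_norm_deriv_le (f := f) (s := Set.univ) (C := L)
      (fun z _ => hd z) (fun z _ => hbd z) convex_univ (Set.mem_univ y) (Set.mem_univ x)
  | succ k ih => exact ⟨hf.1, hf.2.1, ih hf.2.2⟩

lemma to_zero (ha : 0 ≤ a) (ha1 : a ≤ 1) (hf : PerHolder a k f) : PerHolder a 0 f := by
  induction k with
  | zero => exact hf
  | succ k ih => exact ih (hf.of_succ ha ha1)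

lemma continuous (ha : 0 < a) (ha1 : a ≤ 1) (hf : PerHolder a k f) : Continuous f := by
  obtain ⟨-, C, hC, h⟩ := hf.to_zero ha.le ha1
  rw [continuous_iff_continuousAt]
  intro x
  rw [ContinuousAt, tendsto_iff_norm_sub_tendsto_zero]
  refine squeeze_zero (fun _ => norm_nonneg _) (fun y => h y x) ?_
  have : Continuous fun y : ℝ => C * |y - x| ^ a := by
    refine continuous_const.mul (Continuous.rpow_const (by fun_prop) fun _ => Or.inr ha.le)
  simpa [Real.zero_rpow ha.ne'] using this.tendsto x

lemma const (c : ℂ) : PerHolder a k fun _ => c := by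
  induction k generalizing c with
  | zero => exact ⟨fun _ => rfl, 0, le_rfl, by simp⟩
  | succ k ih =>
    refine ⟨fun _ => rfl, differentiable_const _, ?_⟩
    rw [deriv_const']; exact ih 0

lemma add (hf : PerHolder a k f) (hg : PerHolder a k g) : PerHolder a k fun x => f x + g x := by
  induction k generalizing f g with
  | zero =>
    obtain ⟨hp, C, hC, h⟩ := hf
    obtain ⟨hp', C', hC', h'⟩ := hg
    refine ⟨hp.add hp', C + C', by positivity, fun x y => ?_⟩
    calc _ = ‖(f x - f y) + (g x - g y)‖ := by congr 1; ring
      _ ≤ _ := norm_add_le _ _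
      _ ≤ _ := by linarith [h x y, h' x y]
  | succ k ih =>
    refine ⟨hf.1.add hg.1, hf.2.1.add hg.2.1, ?_⟩
    have : deriv (fun x => f x + g x) = fun x => deriv f x + deriv g x :=
      funext fun x => deriv_fun_add (hf.2.1 x) (hg.2.1 x)
    rw [this]
    exact ih hf.2.2 hg.2.2

lemma mul (ha : 0 ≤ a) (ha1 : a ≤ 1) (hf : PerHolder a k f) (hg : PerHolder a k g) :
    PerHolder a k fun x => f x * g x := by
  induction k generalizing f g with
  | zero =>
    obtain ⟨B, hB, hb⟩ := hf.bounded_of_zero ha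
    obtain ⟨B', hB', hb'⟩ := hg.bounded_of_zero ha
    obtain ⟨hp, C, hC, h⟩ := hf
    obtain ⟨hp', C', hC', h'⟩ := hg
    refine ⟨hp.mul hp', C * B' + B * C', by positivity, fun x y => ?_⟩
    calc _ = ‖(f x - f y) * g x + f y * (g x - g y)‖ := by congr 1; ring
      _ ≤ ‖f x - f y‖ * ‖g x‖ + ‖f y‖ * ‖g x - g y‖ := by
        simpa only [norm_mul] using norm_add_le ((f x - f y) * g x) (f y * (g x - g y))
      _ ≤ (C * |x - y| ^ a) * B' + B * (C' * |x - y| ^ a) := by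
        gcongr
        exacts [h x y, hb' x, hb y, h' x y]
      _ = _ := by ring
  | succ k ih =>
    refine ⟨hf.1.mul hg.1, hf.2.1.mul hg.2.1, ?_⟩
    have : deriv (fun x => f x * g x) = fun x => deriv f x * g x + f x * deriv g x :=
      funext fun x => deriv_fun_mul (hf.2.1 x) (hg.2.1 x)
    rw [this]
    exact (ih hf.2.2 (hg.of_succ ha ha1)).add (ih (hf.of_succ ha ha1) hg.2.2)

lemma const_mul (ha : 0 ≤ a) (ha1 : a ≤ 1) (c : ℂ) (hf : PerHolder a k f) :
    PerHolder a k fun x => c * f x := (const c).mul ha ha1 hf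

lemma sub (ha : 0 ≤ a) (ha1 : a ≤ 1) (hf : PerHolder a k f) (hg : PerHolder a k g) :
    PerHolder a k fun x => f x - g x := by
  simpa [sub_eq_add_neg] using hf.add (hg.const_mul ha ha1 (-1))

lemma comp_neg (ha : 0 ≤ a) (ha1 : a ≤ 1) (hf : PerHolder a k f) :
    PerHolder a k fun x => f (-x) := by
  induction k generalizing f with
  | zero =>
    obtain ⟨hp, C, hC, h⟩ := hf
    refine ⟨fun x => ?_, C, hC, fun x y => ?_⟩
    · change f (-(x + _)) = f (-x)
      rw [neg_add, ← sub_eq_add_neg, hp.sub_eq]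
    · have := h (-x) (-y)
      rwa [show -x - -y = -(x - y) by ring, abs_neg] at this
  | succ k ih =>
    refine ⟨fun x => ?_, hf.2.1.comp differentiable_neg, ?_⟩
    · change f (-(x + _)) = f (-x)
      rw [neg_add, ← sub_eq_add_neg, hf.1.sub_eq]
    · have : deriv (fun x => f (-x)) = fun x => (-1) * deriv f (-x) := by
        funext x; rw [deriv_comp_neg]; ring
      rw [this]
      exact (ih hf.2.2).const_mul ha ha1 _

lemma inv (ha : 0 < a) (ha1 : a ≤ 1) (hf : PerHolder a k f) (h0 : ∀ x, f x ≠ 0) :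
    PerHolder a k fun x => (f x)⁻¹ := by
  induction k with
  | zero =>
    have hc : Continuous fun x => (f x)⁻¹ := (hf.continuous ha ha1).inv₀ h0
    have hp : Function.Periodic (fun x => (f x)⁻¹) (2 * Real.pi) := fun x => by
      simp only [hf.periodic x]
    obtain ⟨B, hB, hb⟩ := bounded_periodic hc hp
    obtain ⟨-, C, hC, h⟩ := hf
    refine ⟨hp, B * C * B, by positivity, fun x y => ?_⟩
    rw [inv_sub_inv' (h0 x) (h0 y), norm_mul, norm_mul]
    calc _ ≤ B * (C * |x - y| ^ a) * B := by
          gcongr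
          · exact hb x
          · rw [norm_sub_rev]; exact h x y
          · exact hb y
      _ = _ := by ring
  | succ k ih =>
    have hi := ih (hf.of_succ ha.le ha1)
    refine ⟨hi.periodic, hf.2.1.inv h0, ?_⟩
    have : deriv (fun x => (f x)⁻¹) = fun x => (-1) * (deriv f x * ((f x)⁻¹ * (f x)⁻¹)) := by
      funext x
      rw [(((hf.2.1 x).hasDerivAt).fun_inv (h0 x)).deriv]
      field_simp
    rw [this]
    exact (hf.2.2.mul ha.le ha1 (hi.mul ha.le ha1 hi)).const_mul ha.le ha1 _

lemma of_smooth (ha : 0 ≤ a) (ha1 : a ≤ 1) (hf : ContDiff ℝ ⊤ f)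
    (hp : Function.Periodic f (2 * Real.pi)) : PerHolder a k f := by
  have key : ∀ k : ℕ, ∀ f : ℝ → ℂ, ContDiff ℝ ⊤ f → Function.Periodic f (2 * Real.pi) →
      PerHolder a (k + 1) f := by
    intro k
    induction k with
    | zero =>
      intro f hf hp
      refine ⟨hp, hf.differentiable (by simp), ?_⟩
      have h1 : ContDiff ℝ ⊤ (deriv f) := ((contDiff_succ_iff_deriv (n := ⊤)).1 hf).2.2
      have h2 : ContDiff ℝ ⊤ (deriv (deriv f)) := ((contDiff_succ_iff_deriv (n := ⊤)).1 h1).2.2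
      obtain ⟨L, hL, hbd⟩ := bounded_periodic h2.continuous (deriv_periodic (deriv_periodic hp))
      obtain ⟨B, hB, hb⟩ := bounded_periodic h1.continuous (deriv_periodic hp)
      refine zero_of_lipschitz ha ha1 hL hB (deriv_periodic hp) (fun x y => ?_) hb
      simpa using Convex.norm_image_sub_le_of_norm_deriv_le (f := deriv f) (s := Set.univ) (C := L)
        (fun z _ => h1.differentiable (by simp) z) (fun z _ => hbd z) convex_univ
        (Set.mem_univ y) (Set.mem_univ x)
    | succ k ih =>
      intro f hf hp
      exact ⟨hp, hf.differentiable (by simp),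
        ih _ ((contDiff_succ_iff_deriv (n := ⊤)).1 hf).2.2 (deriv_periodic hp)⟩
  exact (key k f hf hp).of_succ ha ha1

end PerHolder

lemma holder_iff_perHolder_zero {a : ℝ} (ha : 0 ≤ a) {f : ℝ → ℂ}
    (hp : Function.Periodic f (2 * Real.pi)) :
    (∃ C : NNReal, HolderWith C a.toNNReal f) ↔ PerHolder a 0 f := by
  constructor
  · rintro ⟨C, hC⟩
    refine ⟨hp, C, C.2, fun x y => ?_⟩
    have := hC.dist_le x y
    rwa [dist_eq_norm, Real.dist_eq, Real.coe_toNNReal a ha] at this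
  · rintro ⟨-, C, hC, h⟩
    refine ⟨C.toNNReal, fun x y => ?_⟩
    rw [edist_nndist, edist_nndist, ← ENNReal.coe_rpow_of_nonneg _ NNReal.zero_le_coe,
      ← ENNReal.coe_mul, ENNReal.coe_le_coe, ← NNReal.coe_le_coe]
    have := h x y
    simpa [Real.coe_toNNReal, hC, ha, dist_eq_norm] using this

/-- The recursive form lets sums, products and inverses be treated by induction on the order, one
derivative at a time. -/
lemma perHolder_iff {a : ℝ} (ha : 0 < a) (ha1 : a ≤ 1) (k : ℕ) {f : ℝ → ℂ}
    (hp : Function.Periodic f (2 * Real.pi)) :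
    (ContDiff ℝ k f ∧ ∃ C : NNReal, HolderWith C a.toNNReal (iteratedDeriv k f)) ↔
      PerHolder a k f := by
  induction k generalizing f with
  | zero =>
    rw [← holder_iff_perHolder_zero ha.le hp]
    simp only [iteratedDeriv_zero, Nat.cast_zero, contDiff_zero]
    refine ⟨fun h => h.2, fun h => ⟨?_, h⟩⟩
    exact ((holder_iff_perHolder_zero ha.le hp).1 h).continuous ha ha1
  | succ k ih =>
    have := ih (PerHolder.deriv_periodic hp)
    rw [iteratedDeriv_succ']
    simp only [PerHolder, Nat.cast_add, Nat.cast_one, contDiff_succ_iff_deriv]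
    constructor
    · rintro ⟨⟨h1, -, h2⟩, h3⟩
      exact ⟨hp, h1, this.1 ⟨h2, h3⟩⟩
    · rintro ⟨-, h1, h2⟩
      obtain ⟨h3, h4⟩ := this.2 h2
      exact ⟨⟨h1, by simp, h3⟩, h4⟩

lemma periodic_circle_exp (φ : Circle → ℂ) :
    Function.Periodic (fun θ : ℝ => φ (Circle.exp θ)) (2 * Real.pi) := fun θ => by
  simp only [Circle.exp_add, Circle.exp_two_pi, mul_one]

lemma fract_pos {s : ℝ} (hs : 0 < s) (hs_int : ∀ n : ℤ, s ≠ n) : 0 < s - ⌊s⌋₊ := by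
  have h1 := Nat.floor_le hs.le
  have h2 : s ≠ (⌊s⌋₊ : ℝ) := by simpa using hs_int ⌊s⌋₊
  exact sub_pos.2 (lt_of_le_of_ne h1 h2.symm)

lemma isHolderCs_iff {s : ℝ} (hs : 0 < s) (hs_int : ∀ n : ℤ, s ≠ n) (φ : Circle → ℂ) :
    IsHolderCs s φ ↔ PerHolder (s - ⌊s⌋₊) ⌊s⌋₊ fun θ : ℝ => φ (Circle.exp θ) :=
  perHolder_iff (fract_pos hs hs_int) (by linarith [Nat.lt_floor_add_one s]) _
    (periodic_circle_exp φ)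

end SLLoop

/-! ### The Cauchy transform inside the disk and its derivative. -/

namespace SLLoop

open Complex in
/-- Cauchy transform on the unit disk of a function of the angle. -/
noncomputable def cauchyTransform (h : ℝ → ℂ) (z : ℂ) : ℂ :=
  (2 * Real.pi : ℂ)⁻¹ * ∫ θ in (0 : ℝ)..2 * Real.pi, h θ * (exp (θ * I) / (exp (θ * I) - z))

section Kernel

open Complex

lemma exp_mul_I_sub_ne {z : ℂ} (hz : ‖z‖ < 1) (θ : ℝ) : exp (θ * I) - z ≠ 0 := by
  intro h
  rw [sub_eq_zero] at h
  rw [← h, norm_exp_ofReal_mul_I] at hz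
  exact lt_irrefl _ hz

lemma one_sub_le_norm_exp_mul_I_sub (z : ℂ) (θ : ℝ) : 1 - ‖z‖ ≤ ‖exp (θ * I) - z‖ := by
  have := norm_sub_norm_le (exp (θ * I)) z
  rwa [norm_exp_ofReal_mul_I] at this

lemma exp_mul_I_periodic : Function.Periodic (fun θ : ℝ => exp (θ * I)) (2 * Real.pi) := fun θ => by
  push_cast
  rw [add_mul, exp_periodic]

lemma hasDerivAt_exp_mul_I (θ : ℝ) :
    HasDerivAt (fun θ : ℝ => exp (θ * I)) (exp (θ * I) * I) θ := by
  simpa using ((hasDerivAt_id θ).ofReal_comp.mul_const I).cexp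

/-- Jordan's inequality gives `2|t|/π ≤ |e^{it} - 1|`, and the right side is at most `|e^{it} - r| +
(1 - r) ≤ 2|e^{it} - r|`. Adding `1 - r ≤ |e^{it} - r|` gives the constant `1 + π ≤ 2π`. -/
lemma norm_exp_mul_I_sub_lower {r t : ℝ} (hr0 : 0 ≤ r) (hr : r ≤ 1) (ht : |t| ≤ Real.pi) :
    (1 - r + |t|) / (2 * Real.pi) ≤ ‖exp (t * I) - r‖ := by
  have hpi := Real.pi_pos
  have h1 : 1 - r ≤ ‖exp (t * I) - r‖ := by
    simpa [abs_of_nonneg hr0] using one_sub_le_norm_exp_mul_I_sub (r : ℂ) t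
  have h2 : 2 / Real.pi * |t| ≤ ‖exp (t * I) - 1‖ := by
    have := Real.mul_abs_le_abs_sin (x := t / 2) (by rw [abs_div, abs_two]; linarith)
    rw [abs_div, abs_two] at this
    rw [mul_comm (t : ℂ), norm_exp_I_mul_ofReal_sub_one, norm_mul, Real.norm_two, Real.norm_eq_abs]
    linarith
  have h3 : ‖exp (t * I) - 1‖ ≤ ‖exp (t * I) - r‖ + (1 - r) := by
    have := norm_sub_le (exp (t * I) - r) ((1 - r : ℝ) : ℂ)
    rw [norm_real, Real.norm_of_nonneg (sub_nonneg.2 hr)] at this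
    rwa [show exp (t * I) - r - ((1 - r : ℝ) : ℂ) = exp (t * I) - 1 by push_cast; ring] at this
  have h4 : |t| ≤ Real.pi * ‖exp (t * I) - r‖ := by
    have : 2 / Real.pi * |t| ≤ 2 * ‖exp (t * I) - r‖ := by linarith
    rw [div_mul_eq_mul_div, div_le_iff₀ hpi] at this
    linarith
  rw [div_le_iff₀ (by positivity)]
  nlinarith [Real.pi_gt_three, norm_nonneg (exp (t * I) - r)]

lemma integral_add_abs_rpow_le {δ a : ℝ} (hδ : 0 < δ) (ha1 : a < 1) :
    ∫ t in (-Real.pi)..Real.pi, (δ + |t|) ^ (a - 2) ≤ 2 * δ ^ (a - 1) / (1 - a) := by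
  have hpi := Real.pi_pos
  have hc : Continuous fun t : ℝ => (δ + |t|) ^ (a - 2) :=
    Continuous.rpow_const (by fun_prop) fun t => Or.inl (by positivity)
  have h1 : ∫ t in (0 : ℝ)..Real.pi, (δ + |t|) ^ (a - 2) ≤ δ ^ (a - 1) / (1 - a) := by
    have : ∫ t in (0 : ℝ)..Real.pi, (δ + |t|) ^ (a - 2) =
        ∫ t in (0 : ℝ)..Real.pi, (δ + t) ^ (a - 2) := by
      refine intervalIntegral.integral_congr fun t ht => ?_
      rw [Set.uIcc_of_le hpi.le] at ht
      simp only [abs_of_nonneg ht.1]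
    rw [this, intervalIntegral.integral_comp_add_left (fun t => t ^ (a - 2)), integral_rpow]
    · rw [show a - 2 + 1 = -(1 - a) by ring, show a - 1 = -(1 - a) by ring, div_neg, ← neg_div,
        add_zero]
      have := Real.rpow_nonneg (x := δ + Real.pi) (by positivity) (-(1 - a))
      have h1a : 0 < 1 - a := by linarith
      gcongr
      linarith
    · right
      refine ⟨by linarith, fun h => ?_⟩
      rw [Set.uIcc_of_le (by linarith)] at h
      linarith [h.1]
  have h2 : ∫ t in (-Real.pi)..0, (δ + |t|) ^ (a - 2) =
      ∫ t in (0 : ℝ)..Real.pi, (δ + |t|) ^ (a - 2) := by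
    have := intervalIntegral.integral_comp_neg (a := 0) (b := Real.pi)
      fun t : ℝ => (δ + |t|) ^ (a - 2)
    simp only [abs_neg, neg_zero] at this
    exact this.symm
  rw [← intervalIntegral.integral_add_adjacent_intervals (b := 0) (hc.intervalIntegrable _ _)
    (hc.intervalIntegrable _ _), h2]
  linarith [mul_div_assoc 2 (δ ^ (a - 1)) (1 - a)]

/-- Common estimate for the differentiated Cauchy kernel and the Poisson kernel: with `|t| ^ a ≤ (1
- r + |t|) ^ a` the integrand is dominated by a multiple of `(1 - r + |t|) ^ (a - 2)`. -/
lemma norm_integral_le_of_kernel {r a C : ℝ} (hr0 : 0 ≤ r) (hr : r < 1) (ha : 0 < a) (ha1 : a < 1)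
    (hC : 0 ≤ C) {f : ℝ → ℂ}
    (hf : ∀ t, |t| ≤ Real.pi → ‖f t‖ ≤ C * |t| ^ a / ‖exp (t * I) - r‖ ^ 2) :
    ‖∫ t in (-Real.pi)..Real.pi, f t‖ ≤
      C * (2 * Real.pi) ^ 2 * (2 * (1 - r) ^ (a - 1) / (1 - a)) := by
  have hpi := Real.pi_pos
  have hδ : 0 < 1 - r := by linarith
  have hc : Continuous fun t : ℝ => (1 - r + |t|) ^ (a - 2) :=
    Continuous.rpow_const (by fun_prop) fun t => Or.inl (by positivity)
  calc _ ≤ ∫ t in (-Real.pi)..Real.pi, C * (2 * Real.pi) ^ 2 * (1 - r + |t|) ^ (a - 2) := by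
        refine intervalIntegral.norm_integral_le_of_norm_le (by linarith) (.of_forall fun t ht => ?_)
          ((hc.const_mul _).intervalIntegrable _ _)
        have ht' : |t| ≤ Real.pi := abs_le.2 ⟨ht.1.le, ht.2⟩
        have hl := norm_exp_mul_I_sub_lower hr0 hr.le ht'
        have hp : 0 < 1 - r + |t| := by positivity
        refine (hf t ht').trans ?_
        calc _ ≤ C * (1 - r + |t|) ^ a / ((1 - r + |t|) / (2 * Real.pi)) ^ 2 := by
              gcongr
              linarith
          _ = _ := by
              rw [Real.rpow_sub hp, Real.rpow_two]
              field_simp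
    _ ≤ _ := by
        rw [intervalIntegral.integral_const_mul]
        gcongr
        exact integral_add_abs_rpow_le hδ ha1

lemma integral_eq_integral_shift {g : ℝ → ℂ} (hg : Function.Periodic g (2 * Real.pi)) (φ : ℝ) :
    ∫ θ in (0 : ℝ)..2 * Real.pi, g θ = ∫ t in (-Real.pi)..Real.pi, g (φ + t) := by
  rw [intervalIntegral.integral_comp_add_left]
  have := hg.intervalIntegral_add_eq 0 (φ + -Real.pi)
  rw [zero_add] at this
  rw [this]
  congr 1; ring

lemma hasDerivAt_cauchyTransform {h : ℝ → ℂ} (hc : Continuous h) {z : ℂ} (hz : ‖z‖ < 1) :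
    HasDerivAt (cauchyTransform h) ((2 * Real.pi : ℂ)⁻¹ *
      ∫ θ in (0 : ℝ)..2 * Real.pi, h θ * (exp (θ * I) / (exp (θ * I) - z) ^ 2)) z := by
  -- Half the distance to the circle: on this ball the kernel's denominator stays at least `d` in
  -- modulus.
  set d := (1 - ‖z‖) / 2 with hd
  have hd0 : 0 < d := by rw [hd]; linarith
  have hlow : ∀ w ∈ Metric.ball z d, ‖w‖ < 1 - d := fun w hw => by
    have h1 : ‖w - z‖ < d := mem_ball_iff_norm.1 hw
    have h2 : ‖w‖ ≤ ‖w - z‖ + ‖z‖ := by simpa using norm_add_le (w - z) z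
    linarith
  have hcont : ∀ w : ℂ, ‖w‖ < 1 →
      Continuous fun θ : ℝ => h θ * (exp (θ * I) / (exp (θ * I) - w)) := fun w hw =>
    hc.mul (Continuous.div (by fun_prop) (by fun_prop) fun θ => exp_mul_I_sub_ne hw θ)
  have hcont' : Continuous fun θ : ℝ => h θ * (exp (θ * I) / (exp (θ * I) - z) ^ 2) :=
    hc.mul (Continuous.div (by fun_prop) (by fun_prop) fun θ =>
      pow_ne_zero _ (exp_mul_I_sub_ne hz θ))
  refine HasDerivAt.const_mul _ ?_
  refine (intervalIntegral.hasDerivAt_integral_of_dominated_loc_of_deriv_le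
    (F := fun w θ => h θ * (exp (θ * I) / (exp (θ * I) - w)))
    (F' := fun w θ => h θ * (exp (θ * I) / (exp (θ * I) - w) ^ 2))
    (bound := fun θ => ‖h θ‖ * (1 / d ^ 2)) (Metric.ball_mem_nhds z hd0) ?_
    ((hcont z hz).intervalIntegrable _ _) hcont'.aestronglyMeasurable ?_
    ((hc.norm.mul_const _).intervalIntegrable _ _) ?_).2
  · filter_upwards [Metric.ball_mem_nhds z hd0] with w hw
    exact (hcont w (by linarith [hlow w hw])).aestronglyMeasurable
  · refine .of_forall fun θ _ w hw => ?_
    rw [norm_mul, norm_div, norm_pow, norm_exp_ofReal_mul_I]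
    gcongr
    have := one_sub_le_norm_exp_mul_I_sub w θ
    linarith [hlow w hw]
  · refine .of_forall fun θ _ w hw => ?_
    have hne := exp_mul_I_sub_ne (z := w) (by linarith [hlow w hw]) θ
    exact (((hasDerivAt_const w (exp (θ * I))).fun_div
      ((hasDerivAt_id' w).const_sub (exp (θ * I))) hne).const_mul (h θ)).congr_deriv (by simp)

/-- Integration by parts with the primitive `I / (e^{iθ} - z)`; periodicity cancels the boundary
terms. -/
lemma integral_mul_kernel_sq {h h' : ℝ → ℂ} (hh : ∀ θ, HasDerivAt h (h' θ) θ) (hc : Continuous h')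
    (hp : Function.Periodic h (2 * Real.pi)) {z : ℂ} (hz : ‖z‖ < 1) :
    ∫ θ in (0 : ℝ)..2 * Real.pi, h θ * (exp (θ * I) / (exp (θ * I) - z) ^ 2) =
      -I * ∫ θ in (0 : ℝ)..2 * Real.pi, h' θ * (exp (θ * I) - z)⁻¹ := by
  have hne := exp_mul_I_sub_ne hz
  have hv : ∀ θ : ℝ, HasDerivAt (fun θ : ℝ => I * (exp (θ * I) - z)⁻¹)
      (exp (θ * I) / (exp (θ * I) - z) ^ 2) θ := fun θ => by
    refine ((((hasDerivAt_exp_mul_I θ).sub_const z).fun_inv (hne θ)).const_mul I).congr_deriv ?_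
    linear_combination (-exp (θ * I) / (exp (θ * I) - z) ^ 2) * I_sq
  have hcv : Continuous fun θ : ℝ => exp (θ * I) / (exp (θ * I) - z) ^ 2 :=
    Continuous.div (by fun_prop) (by fun_prop) fun θ => pow_ne_zero _ (hne θ)
  rw [intervalIntegral.integral_mul_deriv_eq_deriv_mul (fun θ _ => hh θ) (fun θ _ => hv θ)
    (hc.intervalIntegrable _ _) (hcv.intervalIntegrable _ _)]
  have h1 := hp 0
  have h2 := exp_mul_I_periodic 0
  simp only [zero_add] at h1 h2
  rw [h1, h2, sub_self, zero_sub, ← intervalIntegral.integral_const_mul,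
    ← intervalIntegral.integral_neg]
  congr 1; funext θ; ring

lemma integral_kernel_sq {z : ℂ} (hz : ‖z‖ < 1) :
    ∫ θ in (0 : ℝ)..2 * Real.pi, exp (θ * I) / (exp (θ * I) - z) ^ 2 = 0 := by
  simpa using integral_mul_kernel_sq (h := fun _ => 1) (h' := fun _ => 0)
    (fun θ => hasDerivAt_const _ _) continuous_const (fun _ => rfl) hz

lemma differentiableOn_cauchyTransform {h : ℝ → ℂ} (hc : Continuous h) :
    DifferentiableOn ℂ (cauchyTransform h) disk := fun z hz =>
  (hasDerivAt_cauchyTransform hc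
    (by simpa [disk] using hz)).differentiableAt.differentiableWithinAt

lemma cauchyTransform_one {z : ℂ} (hz : ‖z‖ < 1) : cauchyTransform (fun _ => 1) z = 1 := by
  have h := circleIntegral.integral_sub_inv_of_mem_ball (c := 0) (R := 1) (w := z) (by simpa using hz)
  have h1 : (∮ ζ in C(0, 1), (ζ - z)⁻¹) =
      I * ∫ θ in (0 : ℝ)..2 * Real.pi, 1 * (exp (θ * I) / (exp (θ * I) - z)) := by
    rw [circleIntegral, ← intervalIntegral.integral_const_mul]
    congr 1; funext θ
    simp [deriv_circleMap, circleMap]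
    ring
  rw [h1] at h
  rw [cauchyTransform]
  have hpi : (Real.pi : ℂ) ≠ 0 := by exact_mod_cast Real.pi_ne_zero
  have : ∫ θ in (0 : ℝ)..2 * Real.pi, (1 : ℂ) * (exp (θ * I) / (exp (θ * I) - z)) =
      2 * Real.pi := by
    apply mul_left_cancel₀ I_ne_zero
    rw [h]; ring
  rw [this]
  field_simp

/-- The differentiated kernel has integral zero, so `h θ` may be replaced by `h θ - h φ` with `φ =
arg z`; the Hölder bound then tames the singularity near `φ`. -/
lemma norm_deriv_cauchyTransform_le {a : ℝ} (ha : 0 < a) (ha1 : a < 1) {h : ℝ → ℂ}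
    (hh : PerHolder a 0 h) :
    ∃ M, 0 ≤ M ∧ ∀ z ∈ disk, ‖deriv (cauchyTransform h) z‖ ≤ M * (1 - ‖z‖) ^ (a - 1) := by
  have hc := hh.continuous ha ha1.le
  obtain ⟨hp, C, hC, hCh⟩ := hh
  have hpi := Real.pi_pos
  have h1a : 0 < 1 - a := by linarith
  refine ⟨(2 * Real.pi)⁻¹ * (C * (2 * Real.pi) ^ 2 * (2 / (1 - a))), by positivity, fun z hz => ?_⟩
  have hz1 : ‖z‖ < 1 := by simpa [disk] using hz
  rw [(hasDerivAt_cauchyTransform hc hz1).deriv]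
  set φ := arg z
  have hzφ : z = ‖z‖ * exp (φ * I) := (norm_mul_exp_arg_mul_I z).symm
  have hcont : ∀ g : ℝ → ℂ, Continuous g →
      Continuous fun θ : ℝ => g θ * (exp (θ * I) / (exp (θ * I) - z) ^ 2) := fun g hg =>
    hg.mul (Continuous.div (by fun_prop) (by fun_prop) fun θ =>
      pow_ne_zero _ (exp_mul_I_sub_ne hz1 θ))
  have e1 : ∫ θ in (0 : ℝ)..2 * Real.pi, h θ * (exp (θ * I) / (exp (θ * I) - z) ^ 2) =
      ∫ θ in (0 : ℝ)..2 * Real.pi, (h θ - h φ) * (exp (θ * I) / (exp (θ * I) - z) ^ 2) := by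
    simp_rw [sub_mul]
    rw [intervalIntegral.integral_sub ((hcont h hc).intervalIntegrable _ _)
      ((hcont _ continuous_const).intervalIntegrable _ _), intervalIntegral.integral_const_mul,
      integral_kernel_sq hz1]
    ring
  have e2 : Function.Periodic (fun θ : ℝ => (h θ - h φ) * (exp (θ * I) / (exp (θ * I) - z) ^ 2))
      (2 * Real.pi) := fun θ => by
    have := exp_mul_I_periodic θ
    simp only at this
    simp only [hp θ, this]
  rw [e1, integral_eq_integral_shift e2 φ, norm_mul]
  have := norm_integral_le_of_kernel (norm_nonneg z) hz1 ha ha1 hC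
    (f := fun t => (h (φ + t) - h φ) *
      (exp ((φ + t : ℝ) * I) / (exp ((φ + t : ℝ) * I) - z) ^ 2)) fun t ht => by
    have h1 := hCh (φ + t) φ
    rw [add_sub_cancel_left] at h1
    have h2 : exp ((φ + t : ℝ) * I) - z = exp (φ * I) * (exp (t * I) - ‖z‖) := by
      conv_lhs => rw [hzφ]
      push_cast
      rw [add_mul, exp_add]; ring
    rw [h2, norm_mul, norm_div, norm_pow, norm_mul, norm_exp_ofReal_mul_I, norm_exp_ofReal_mul_I,
      one_mul, mul_one_div]
    gcongr
  have h3 : ‖(2 * Real.pi : ℂ)⁻¹‖ = (2 * Real.pi)⁻¹ := by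
    rw [norm_inv, norm_mul, norm_real, Real.norm_of_nonneg hpi.le]; simp
  rw [h3]
  calc _ ≤ (2 * Real.pi)⁻¹ * (C * (2 * Real.pi) ^ 2 * (2 * (1 - ‖z‖) ^ (a - 1) / (1 - a))) := by
        gcongr
    _ = _ := by ring

/-- The factor `z * I` turns the complex derivative into the angular one, so the transform commutes
with `d/dθ`. Since `h'` has mean zero, its kernel may be lowered by `1` to `z / (e^{iθ} - z)`. -/
lemma cauchyTransform_deriv {h h' : ℝ → ℂ} (hh : ∀ θ, HasDerivAt h (h' θ) θ) (hc : Continuous h')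
    (hp : Function.Periodic h (2 * Real.pi)) {z : ℂ} (hz : ‖z‖ < 1) :
    HasDerivAt (cauchyTransform h) (deriv (cauchyTransform h) z) z ∧
      deriv (cauchyTransform h) z * (z * I) = cauchyTransform h' z := by
  have hd := hasDerivAt_cauchyTransform (continuous_iff_continuousAt.2 fun θ => (hh θ).continuousAt) hz
  refine ⟨hd.differentiableAt.hasDerivAt, ?_⟩
  have hne := exp_mul_I_sub_ne hz
  have h0 : ∫ θ in (0 : ℝ)..2 * Real.pi, h' θ = 0 := by
    rw [intervalIntegral.integral_eq_sub_of_hasDerivAt (fun θ _ => hh θ)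
      (hc.intervalIntegrable _ _)]
    have := hp 0
    simp only [zero_add] at this
    rw [this, sub_self]
  have hcv : Continuous fun θ : ℝ => h' θ * (exp (θ * I) - z)⁻¹ :=
    hc.mul (Continuous.inv₀ (by fun_prop) hne)
  rw [hd.deriv, integral_mul_kernel_sq hh hc hp hz, cauchyTransform]
  have : ∫ θ in (0 : ℝ)..2 * Real.pi, h' θ * (exp (θ * I) / (exp (θ * I) - z)) =
      z * ∫ θ in (0 : ℝ)..2 * Real.pi, h' θ * (exp (θ * I) - z)⁻¹ := by
    rw [← sub_zero (∫ θ in (0 : ℝ)..2 * Real.pi, h' θ * (exp (θ * I) / (exp (θ * I) - z))), ← h0,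
      ← intervalIntegral.integral_sub, ← intervalIntegral.integral_const_mul]
    · congr 1; funext θ
      have := hne θ
      field_simp
      ring
    · exact (hc.mul (Continuous.div (by fun_prop) (by fun_prop) hne)).intervalIntegrable _ _
    · exact hc.intervalIntegrable _ _
  rw [this]
  linear_combination (-(2 * Real.pi : ℂ)⁻¹ * z * ∫ θ in (0 : ℝ)..2 * Real.pi,
    h' θ * (exp (θ * I) - z)⁻¹) * I_sq

end Kernel

end SLLoop

/-! ### Hölder regularity of the Cauchy transform up to the circle. -/

namespace SLLoop

open Complex Filter

lemma closure_disk : closure disk = Metric.closedBall 0 1 := closure_ball 0 one_ne_zero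

lemma mem_disk {z : ℂ} : z ∈ disk ↔ ‖z‖ < 1 := by simp [disk]

lemma smul_mem_disk {r : ℝ} (hr0 : 0 ≤ r) (hr : r < 1) {z : ℂ} (hz : ‖z‖ ≤ 1) : r * z ∈ disk := by
  rw [mem_disk, norm_mul, norm_real, Real.norm_of_nonneg hr0]
  nlinarith [norm_nonneg z]

/-- Radial part of the Hardy–Littlewood estimate. -/
lemma norm_sub_radial_le {F : ℂ → ℂ} {M a : ℝ} (ha : 0 < a) (ha1 : a < 1) (hM : 0 ≤ M)
    (hF : DifferentiableOn ℂ F disk)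
    (hd : ∀ z ∈ disk, ‖deriv F z‖ ≤ M * (1 - ‖z‖) ^ (a - 1)) {z : ℂ} (hz : z ∈ disk) {ρ : ℝ}
    (hρ0 : 0 ≤ ρ) (hρ : ρ ≤ 1) : ‖F z - F (ρ * z)‖ ≤ M / a * (1 - ρ) ^ a := by
  have hz1 := mem_disk.1 hz
  have hmem : ∀ t ∈ Set.Icc ρ 1, (t : ℂ) * z ∈ disk := fun t ht => by
    rw [mem_disk, norm_mul, norm_real, Real.norm_of_nonneg (hρ0.trans ht.1)]
    nlinarith [norm_nonneg z, ht.2]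
  have hder : ∀ t ∈ Set.Icc ρ 1,
      HasDerivAt (fun t : ℝ => F (t * z) - F (ρ * z)) (deriv F (t * z) * z) t := fun t ht => by
    have h1 := (hF.differentiableAt (Metric.isOpen_ball.mem_nhds (hmem t ht))).hasDerivAt
    have h2 : HasDerivAt (fun t : ℝ => (t : ℂ) * z) z t := by
      simpa using (hasDerivAt_id t).ofReal_comp.mul_const z
    exact (h1.comp t h2).sub_const _
  have hpos : ∀ t ∈ Set.Icc ρ 1, 0 < 1 - t * ‖z‖ := fun t ht => by
    nlinarith [norm_nonneg z, ht.2]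
  -- An explicit primitive of the derivative bound along the radius, vanishing at `t = ρ`.
  have hB : ∀ t ∈ Set.Icc ρ 1, HasDerivAt
      (fun t : ℝ => M / a * ((1 - ρ * ‖z‖) ^ a - (1 - t * ‖z‖) ^ a))
      (M * (1 - t * ‖z‖) ^ (a - 1) * ‖z‖) t := fun t ht => by
    have h1 : HasDerivAt (fun t : ℝ => 1 - t * ‖z‖) (-‖z‖) t := by
      simpa using ((hasDerivAt_id t).mul_const ‖z‖).const_sub 1
    refine (((h1.rpow_const (p := a) (Or.inl (hpos t ht).ne')).const_sub _).const_mul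
      (M / a)).congr_deriv ?_
    field_simp
  have key := image_norm_le_of_norm_deriv_right_le_deriv_boundary'
    (fun t ht => (hder t ht).continuousAt.continuousWithinAt)
    (fun t ht => (hder t (Set.Ico_subset_Icc_self ht)).hasDerivWithinAt)
    (by simp)
    (fun t ht => (hB t ht).continuousAt.continuousWithinAt)
    (fun t ht => (hB t (Set.Ico_subset_Icc_self ht)).hasDerivWithinAt)
    (fun t ht => by
      have ht' := Set.Ico_subset_Icc_self ht
      rw [norm_mul]
      gcongr
      have := hd _ (hmem t ht')
      rwa [norm_mul, norm_real, Real.norm_of_nonneg (hρ0.trans ht.1)] at this)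
    (Set.right_mem_Icc.2 hρ)
  simp only [ofReal_one, one_mul] at key
  refine key.trans ?_
  gcongr
  -- Subadditivity of `x ^ a` bounds the increment of the primitive by `(1 - ρ) ^ a`, uniformly in
  -- `z`.
  have h1 := Real.rpow_add_le_add_rpow (a := 1 - ‖z‖) (b := ‖z‖ * (1 - ρ)) (p := a) (by linarith)
    (mul_nonneg (norm_nonneg z) (by linarith)) ha.le ha1.le
  have h2 : (‖z‖ * (1 - ρ)) ^ a ≤ (1 - ρ) ^ a := by
    refine Real.rpow_le_rpow (mul_nonneg (norm_nonneg z) (by linarith)) ?_ ha.le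
    exact mul_le_of_le_one_left (by linarith) hz1.le
  rw [show 1 - ‖z‖ + ‖z‖ * (1 - ρ) = 1 - ρ * ‖z‖ by ring] at h1
  linarith

/-- The Hardy–Littlewood criterion for Hölder continuity on the disk. -/
lemma exists_holder_of_norm_deriv_le {F : ℂ → ℂ} {M a : ℝ} (ha : 0 < a) (ha1 : a < 1) (hM : 0 ≤ M)
    (hF : DifferentiableOn ℂ F disk)
    (hd : ∀ z ∈ disk, ‖deriv F z‖ ≤ M * (1 - ‖z‖) ^ (a - 1)) :
    ∃ C, 0 ≤ C ∧ ∀ z ∈ disk, ∀ w ∈ disk, ‖F z - F w‖ ≤ C * ‖z - w‖ ^ a := by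
  refine ⟨2 * (M / a) + M, by positivity, fun z hz w hw => ?_⟩
  -- The path from `z` to `w` moves inward by the factor `1 - δ`, across, and outward. For `δ = ‖z -
  -- w‖` the crossing costs `M * δ ^ (a - 1) * δ = M * δ ^ a`.
  have mid : ∀ δ : ℝ, 0 < δ → δ ≤ 1 → ∀ z ∈ disk, ∀ w ∈ disk,
      ‖F ((1 - δ : ℝ) * z) - F ((1 - δ : ℝ) * w)‖ ≤ M * δ ^ (a - 1) * ‖z - w‖ := by
    intro δ hδ hδ1 z hz w hw
    have hz1 := mem_disk.1 hz
    have hw1 := mem_disk.1 hw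
    have hsub : Metric.closedBall (0 : ℂ) (1 - δ) ⊆ disk := fun x hx =>
      mem_disk.2 (by linarith [mem_closedBall_zero_iff.1 hx])
    have hm : ∀ z ∈ disk, ((1 - δ : ℝ) : ℂ) * z ∈ Metric.closedBall (0 : ℂ) (1 - δ) := fun z hz => by
      rw [mem_closedBall_zero_iff, norm_mul, norm_real, Real.norm_of_nonneg (by linarith)]
      exact mul_le_of_le_one_right (by linarith) (mem_disk.1 hz).le
    have := Convex.norm_image_sub_le_of_norm_deriv_le (𝕜 := ℂ) (f := F) (C := M * δ ^ (a - 1))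
      (fun x hx => hF.differentiableAt (Metric.isOpen_ball.mem_nhds (hsub hx)))
      (fun x hx => by
        refine (hd x (hsub hx)).trans ?_
        gcongr ?_ * ?_
        refine Real.rpow_le_rpow_of_nonpos hδ ?_ (by linarith)
        linarith [mem_closedBall_zero_iff.1 hx])
      (convex_closedBall _ _) (hm w hw) (hm z hz)
    refine this.trans ?_
    rw [← mul_sub, norm_mul, norm_real, Real.norm_of_nonneg (by linarith)]
    gcongr
    exact mul_le_of_le_one_left (norm_nonneg _) (by linarith)
  rcases eq_or_ne z w with rfl | hne
  · simp only [sub_self, norm_zero]; positivity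
  have hpos : 0 < ‖z - w‖ := norm_pos_iff.2 (sub_ne_zero.2 hne)
  have tri : ∀ x y, ‖F z - F w‖ ≤ ‖F z - F x‖ + ‖F x - F y‖ + ‖F w - F y‖ := fun x y => by
    calc _ = ‖(F z - F x) + (F x - F y) - (F w - F y)‖ := by congr 1; ring
      _ ≤ ‖(F z - F x) + (F x - F y)‖ + ‖F w - F y‖ := norm_sub_le _ _
      _ ≤ _ := by gcongr; exact norm_add_le _ _
  rcases le_total ‖z - w‖ 1 with h | h
  · have t1 := tri ((1 - ‖z - w‖ : ℝ) * z) ((1 - ‖z - w‖ : ℝ) * w)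
    have h1 := norm_sub_radial_le ha ha1 hM hF hd hz (ρ := 1 - ‖z - w‖) (by linarith) (by linarith)
    have h2 := norm_sub_radial_le ha ha1 hM hF hd hw (ρ := 1 - ‖z - w‖) (by linarith) (by linarith)
    have h3 := mid _ hpos h z hz w hw
    rw [sub_sub_cancel] at h1 h2
    rw [mul_assoc, ← Real.rpow_add_one hpos.ne', sub_add_cancel] at h3
    linarith
  -- For points at distance at least `1` both legs run to the centre.
  · have t1 := tri ((0 : ℝ) * z) ((0 : ℝ) * w)
    have h1 := norm_sub_radial_le ha ha1 hM hF hd hz (ρ := 0) le_rfl zero_le_one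
    have h2 := norm_sub_radial_le ha ha1 hM hF hd hw (ρ := 0) le_rfl zero_le_one
    have h3 : ‖F ((0 : ℝ) * z) - F ((0 : ℝ) * w)‖ = 0 := by simp
    rw [sub_zero, Real.one_rpow] at h1 h2
    have h4 := Real.one_le_rpow h ha.le
    calc _ ≤ (2 * (M / a) + M) * 1 := by linarith
      _ ≤ _ := by gcongr

/-- Extension of the Cauchy transform to the closed disk by continuity. -/
noncomputable def cauchyExt (h : ℝ → ℂ) : ℂ → ℂ := extendFrom disk (cauchyTransform h)

lemma tendsto_radial {F : ℂ → ℂ} (hF : ContinuousOn F (closure disk)) {z : ℂ} (hz : ‖z‖ ≤ 1) :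
    Tendsto (fun r : ℝ => F (r * z)) (𝓝[<] 1) (𝓝 (F z)) := by
  have h1 : Tendsto (fun r : ℝ => (r : ℂ) * z) (𝓝[<] 1) (𝓝[closure disk] z) := by
    refine tendsto_nhdsWithin_iff.2 ⟨?_, ?_⟩
    · have : Continuous fun r : ℝ => (r : ℂ) * z := by fun_prop
      simpa using (this.tendsto 1).mono_left nhdsWithin_le_nhds
    · filter_upwards [Ioo_mem_nhdsLT (show (0 : ℝ) < 1 by norm_num)] with r hr
      exact subset_closure (smul_mem_disk hr.1.le hr.2 hz)
  have h2 : z ∈ closure disk := by rw [closure_disk]; simpa using hz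
  exact (hF z h2).tendsto.comp h1

lemma eventually_radial_mem_disk {z : ℂ} (hz : ‖z‖ ≤ 1) : ∀ᶠ r : ℝ in 𝓝[<] 1, r * z ∈ disk := by
  filter_upwards [Ioo_mem_nhdsLT (show (0 : ℝ) < 1 by norm_num)] with r hr
  exact smul_mem_disk hr.1.le hr.2 hz

section Ext

variable {a : ℝ} {h : ℝ → ℂ}

lemma cauchyExt_eq (hh : Continuous h) {z : ℂ} (hz : z ∈ disk) :
    cauchyExt h z = cauchyTransform h z :=
  extendFrom_extends (differentiableOn_cauchyTransform hh).continuousOn z hz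

/-- The Hölder bound makes the transform uniformly continuous on the disk, so it has a limit at
every boundary point by completeness. -/
lemma continuousOn_cauchyExt (ha : 0 < a) (ha1 : a < 1) (hh : PerHolder a 0 h) :
    ContinuousOn (cauchyExt h) (closure disk) := by
  have hc := hh.continuous ha ha1.le
  obtain ⟨M, hM, hd⟩ := norm_deriv_cauchyTransform_le ha ha1 hh
  obtain ⟨C, hC, hH⟩ := exists_holder_of_norm_deriv_le ha ha1 hM
    (differentiableOn_cauchyTransform hc) hd
  have hu : UniformContinuousOn (cauchyTransform h) disk := by
    have : HolderOnWith C.toNNReal a.toNNReal (cauchyTransform h) disk := fun z hz w hw => by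
      rw [edist_nndist, edist_nndist, ← ENNReal.coe_rpow_of_nonneg _ NNReal.zero_le_coe,
        ← ENNReal.coe_mul, ENNReal.coe_le_coe, ← NNReal.coe_le_coe]
      simpa [Real.coe_toNNReal, hC, ha.le, dist_eq_norm] using hH z hz w hw
    exact this.uniformContinuousOn (by simpa using ha)
  refine continuousOn_extendFrom subset_rfl fun x hx => ?_
  have : (𝓝[disk] x).NeBot := mem_closure_iff_nhdsWithin_neBot.1 hx
  exact cauchy_map_iff_exists_tendsto.1
    ((cauchy_nhds.mono nhdsWithin_le_nhds).map_of_le hu inf_le_right)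

lemma exists_holder_cauchyExt (ha : 0 < a) (ha1 : a < 1) (hh : PerHolder a 0 h) :
    ∃ C, 0 ≤ C ∧ ∀ z w, ‖z‖ ≤ 1 → ‖w‖ ≤ 1 → ‖cauchyExt h z - cauchyExt h w‖ ≤ C * ‖z - w‖ ^ a := by
  have hc := hh.continuous ha ha1.le
  have hcont := continuousOn_cauchyExt ha ha1 hh
  obtain ⟨M, hM, hd⟩ := norm_deriv_cauchyTransform_le ha ha1 hh
  obtain ⟨C, hC, hH⟩ := exists_holder_of_norm_deriv_le ha ha1 hM
    (differentiableOn_cauchyTransform hc) hd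
  refine ⟨C, hC, fun z w hz hw => ?_⟩
  have h1 := ((tendsto_radial hcont hz).sub (tendsto_radial hcont hw)).norm
  have h2 : Tendsto (fun r : ℝ => C * ‖(r : ℂ) * z - r * w‖ ^ a) (𝓝[<] 1)
      (𝓝 (C * ‖z - w‖ ^ a)) := by
    have : Continuous fun r : ℝ => C * ‖(r : ℂ) * z - r * w‖ ^ a :=
      continuous_const.mul (Continuous.rpow_const (by fun_prop) fun _ => Or.inr ha.le)
    simpa using (this.tendsto 1).mono_left nhdsWithin_le_nhds
  refine le_of_tendsto_of_tendsto h1 h2 ?_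
  filter_upwards [eventually_radial_mem_disk hz, eventually_radial_mem_disk hw] with r hrz hrw
  rw [cauchyExt_eq hc hrz, cauchyExt_eq hc hrw]
  exact hH _ hrz _ hrw

lemma diffContOnCl_cauchyExt (ha : 0 < a) (ha1 : a < 1) (hh : PerHolder a 0 h) :
    DiffContOnCl ℂ (cauchyExt h) disk where
  differentiableOn := (differentiableOn_cauchyTransform (hh.continuous ha ha1.le)).congr
    fun _ hz => cauchyExt_eq (hh.continuous ha ha1.le) hz
  continuousOn := continuousOn_cauchyExt ha ha1 hh

lemma norm_exp_mul_I_sub_exp_le (x y : ℝ) : ‖exp (x * I) - exp (y * I)‖ ≤ |x - y| := by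
  have : exp (x * I) - exp (y * I) = exp (y * I) * (exp (I * (x - y : ℝ)) - 1) := by
    rw [mul_sub, ← exp_add, mul_one]
    congr 2; push_cast; ring
  rw [this, norm_mul, norm_exp_ofReal_mul_I, one_mul]
  exact Real.norm_exp_I_mul_ofReal_sub_one_le

/-- On the circle of radius `r < 1` the angular derivative is the transform of `deriv h`. Its Hölder
bound makes these derivatives converge uniformly as `r → 1`, so limit and derivative may be
exchanged. -/
lemma hasDerivAt_cauchyExt_boundary (ha : 0 < a) (ha1 : a < 1) (hh : PerHolder a 1 h) (θ : ℝ) :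
    HasDerivAt (fun θ : ℝ => cauchyExt h (exp (θ * I))) (cauchyExt (deriv h) (exp (θ * I))) θ := by
  obtain ⟨hp, hd, hh'⟩ := id hh
  have hc' := hh'.continuous ha ha1.le
  have h0 := hh.to_zero ha.le ha1.le
  obtain ⟨C, hC, hH⟩ := exists_holder_cauchyExt ha ha1 hh'
  refine hasDerivAt_of_tendstoUniformly (l := 𝓝[<] (1 : ℝ))
    (f := fun r θ : ℝ => cauchyTransform h (r * exp (θ * I)))
    (f' := fun r θ : ℝ => cauchyTransform (deriv h) (r * exp (θ * I)))
    (g' := fun θ : ℝ => cauchyExt (deriv h) (exp (θ * I))) ?_ ?_ (fun θ => ?_) θ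
  · rw [Metric.tendstoUniformly_iff]
    intro ε hε
    have h2 : Tendsto (fun r : ℝ => C * (1 - r) ^ a) (𝓝[<] 1) (𝓝 0) := by
      have : Continuous fun r : ℝ => C * (1 - r) ^ a :=
        continuous_const.mul (Continuous.rpow_const (by fun_prop) fun _ => Or.inr ha.le)
      simpa [Real.zero_rpow ha.ne'] using (this.tendsto 1).mono_left nhdsWithin_le_nhds
    filter_upwards [h2.eventually_lt_const hε, Ioo_mem_nhdsLT (show (0 : ℝ) < 1 by norm_num)]
      with r hr hr01 φ
    have hm := smul_mem_disk hr01.1.le hr01.2 (norm_exp_ofReal_mul_I φ).le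
    rw [← cauchyExt_eq hc' hm, dist_eq_norm]
    refine (hH _ _ (norm_exp_ofReal_mul_I φ).le (mem_disk.1 hm).le).trans_lt ?_
    have : exp (φ * I) - r * exp (φ * I) = ((1 - r : ℝ) : ℂ) * exp (φ * I) := by push_cast; ring
    rwa [this, norm_mul, norm_exp_ofReal_mul_I, mul_one, norm_real,
      Real.norm_of_nonneg (by linarith [hr01.2])]
  · filter_upwards [Ioo_mem_nhdsLT (show (0 : ℝ) < 1 by norm_num)] with r hr φ
    have hm := mem_disk.1 (smul_mem_disk hr.1.le hr.2 (norm_exp_ofReal_mul_I φ).le)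
    obtain ⟨h1, h2⟩ := cauchyTransform_deriv (fun θ => (hd θ).hasDerivAt) hc' hp hm
    rw [← h2]
    refine (h1.comp φ ((hasDerivAt_exp_mul_I φ).const_mul (r : ℂ))).congr_deriv ?_
    ring
  · have hn := (norm_exp_ofReal_mul_I θ).le
    refine (tendsto_radial (continuousOn_cauchyExt ha ha1 h0) hn).congr' ?_
    filter_upwards [eventually_radial_mem_disk hn] with r hr
    exact cauchyExt_eq (hh.continuous ha ha1.le) hr

lemma perHolder_cauchyExt (ha : 0 < a) (ha1 : a < 1) {k : ℕ} (hh : PerHolder a k h) :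
    PerHolder a k fun θ : ℝ => cauchyExt h (exp (θ * I)) := by
  have hp : ∀ h : ℝ → ℂ, Function.Periodic (fun θ : ℝ => cauchyExt h (exp (θ * I)))
      (2 * Real.pi) := fun h θ => by
    have := exp_mul_I_periodic θ
    simp only at this
    simp only [this]
  induction k generalizing h with
  | zero =>
    obtain ⟨C, hC, hH⟩ := exists_holder_cauchyExt ha ha1 hh
    refine ⟨hp h, C, hC, fun x y => ?_⟩
    refine (hH _ _ (norm_exp_ofReal_mul_I x).le (norm_exp_ofReal_mul_I y).le).trans ?_
    gcongr
    exact norm_exp_mul_I_sub_exp_le x y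
  | succ k ih =>
    have h1 : PerHolder a 1 h := ⟨hh.1, hh.2.1, hh.2.2.to_zero ha.le ha1.le⟩
    have hder := hasDerivAt_cauchyExt_boundary ha ha1 h1
    refine ⟨hp h, fun θ => (hder θ).differentiableAt, ?_⟩
    rw [show deriv (fun θ : ℝ => cauchyExt h (exp (θ * I))) = _ from funext fun θ => (hder θ).deriv]
    exact ih hh.2.2

end Ext

end SLLoop

/-! ### The Poisson kernel and the Plemelj splitting. -/

namespace SLLoop

open Complex Filter

lemma cauchyTransform_comp_neg {h : ℝ → ℂ} (hp : Function.Periodic h (2 * Real.pi)) (z : ℂ) :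
    cauchyTransform (fun θ => h (-θ)) z = (2 * Real.pi : ℂ)⁻¹ *
      ∫ θ in (0 : ℝ)..2 * Real.pi, h θ * (exp (-(θ * I)) / (exp (-(θ * I)) - z)) := by
  rw [cauchyTransform]
  have h1 := intervalIntegral.integral_comp_neg (a := 0) (b := 2 * Real.pi)
    fun θ : ℝ => h θ * (exp (-(θ * I)) / (exp (-(θ * I)) - z))
  simp only [ofReal_neg, neg_mul, neg_neg, neg_zero] at h1
  have h2 : Function.Periodic
      (fun θ : ℝ => h θ * (exp (-(θ * I)) / (exp (-(θ * I)) - z))) (2 * Real.pi) := fun θ => by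
    have := exp_mul_I_periodic θ
    simp only at this
    simp only [hp θ, exp_neg, this]
  have h3 := h2.intervalIntegral_add_eq (-(2 * Real.pi)) 0
  rw [neg_add_cancel, zero_add] at h3
  rw [h1, h3]

/-- On the unit circle inversion is conjugation, so the second fraction is the conjugate of the
first. -/
lemma poisson_kernel_identity {e ε : ℂ} (he : ‖e‖ = 1) (hε : ‖ε‖ = 1) {r : ℝ} (hr0 : 0 ≤ r)
    (hr : r < 1) :
    e / (e - r * ε) + e⁻¹ / (e⁻¹ - r * ε⁻¹) - 1 = ((1 - r ^ 2) / ‖e - r * ε‖ ^ 2 : ℝ) := by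
  have he0 : e ≠ 0 := norm_ne_zero_iff.1 (by rw [he]; exact one_ne_zero)
  have hε0 : ε ≠ 0 := norm_ne_zero_iff.1 (by rw [hε]; exact one_ne_zero)
  have h1 : e - r * ε ≠ 0 := fun h => by
    rw [sub_eq_zero] at h
    rw [h, norm_mul, norm_real, Real.norm_of_nonneg hr0, hε] at he
    linarith
  have hce : (starRingEnd ℂ) e = e⁻¹ := by rw [inv_def, normSq_eq_norm_sq, he]; simp
  have hcε : (starRingEnd ℂ) ε = ε⁻¹ := by rw [inv_def, normSq_eq_norm_sq, hε]; simp
  have hconj : (starRingEnd ℂ) (e - r * ε) = e⁻¹ - r * ε⁻¹ := by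
    rw [map_sub, map_mul, conj_ofReal, hce, hcε]
  have h2 : e⁻¹ - r * ε⁻¹ ≠ 0 := by
    rw [← hconj]; exact (map_ne_zero _).2 h1
  have h3 : ((‖e - r * ε‖ ^ 2 : ℝ) : ℂ) = (e - r * ε) * (e⁻¹ - r * ε⁻¹) := by
    rw [← hconj, mul_conj, normSq_eq_norm_sq]
  rw [ofReal_div, h3]
  rw [div_add_div _ _ h1 h2, div_sub_one (mul_ne_zero h1 h2)]
  congr 1
  push_cast
  field_simp
  ring

/-- The value at `0` supplies the `-1` of the Poisson kernel identity, because the Cauchy kernel is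
`1` at the centre. -/
lemma cauchyTransform_add_reflect {h : ℝ → ℂ} (hc : Continuous h)
    (hp : Function.Periodic h (2 * Real.pi)) {r : ℝ} (hr0 : 0 ≤ r) (hr : r < 1) (φ : ℝ) :
    cauchyTransform h (r * exp (φ * I)) + cauchyTransform (fun θ => h (-θ)) (r * exp (-(φ * I))) -
        cauchyTransform (fun θ => h (-θ)) 0 =
      (2 * Real.pi : ℂ)⁻¹ * ∫ θ in (0 : ℝ)..2 * Real.pi,
        h θ * ((1 - r ^ 2) / ‖exp (θ * I) - r * exp (φ * I)‖ ^ 2 : ℝ) := by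
  have hz : ‖(r * exp (φ * I) : ℂ)‖ < 1 :=
    mem_disk.1 (smul_mem_disk hr0 hr (norm_exp_ofReal_mul_I φ).le)
  have hz' : ‖(r * exp (-(φ * I)) : ℂ)‖ < 1 := by
    have := mem_disk.1 (smul_mem_disk hr0 hr (norm_exp_ofReal_mul_I (-φ)).le)
    simpa using this
  have hne : ∀ θ : ℝ, exp (-(θ * I)) - r * exp (-(φ * I)) ≠ 0 := fun θ => by
    simpa using exp_mul_I_sub_ne hz' (-θ)
  rw [cauchyTransform_comp_neg hp, cauchyTransform_comp_neg hp, cauchyTransform]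
  have i1 : Continuous fun θ : ℝ => h θ * (exp (θ * I) / (exp (θ * I) - r * exp (φ * I))) :=
    hc.mul (Continuous.div (by fun_prop) (by fun_prop) (exp_mul_I_sub_ne hz))
  have i2 : Continuous fun θ : ℝ => h θ * (exp (-(θ * I)) / (exp (-(θ * I)) - r * exp (-(φ * I)))) :=
    hc.mul (Continuous.div (by fun_prop) (by fun_prop) hne)
  have i3 : Continuous fun θ : ℝ => h θ * (exp (-(θ * I)) / (exp (-(θ * I)) - 0)) :=
    hc.mul (Continuous.div (by fun_prop) (by fun_prop) fun θ => by simp [exp_ne_zero])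
  have i12 : Continuous fun θ : ℝ => h θ * (exp (θ * I) / (exp (θ * I) - r * exp (φ * I))) +
      h θ * (exp (-(θ * I)) / (exp (-(θ * I)) - r * exp (-(φ * I)))) := i1.add i2
  rw [← mul_add, ← mul_sub, ← intervalIntegral.integral_add (i1.intervalIntegrable _ _)
    (i2.intervalIntegrable _ _), ← intervalIntegral.integral_sub
    (i12.intervalIntegrable _ _) (i3.intervalIntegrable _ _)]
  congr 2
  funext θ
  rw [← poisson_kernel_identity (norm_exp_ofReal_mul_I θ) (norm_exp_ofReal_mul_I φ) hr0 hr, exp_neg,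
    exp_neg, sub_zero, div_self (inv_ne_zero (exp_ne_zero _))]
  ring

/-- The Poisson kernel has mean one, so only `h θ - h φ` is integrated. The factor `1 - r ^ 2 ≤ 2 (1
- r)` raises the exponent `a - 1` of the kernel estimate to `a`. -/
lemma norm_poisson_sub_le {a : ℝ} (ha : 0 < a) (ha1 : a < 1) {h : ℝ → ℂ} (hh : PerHolder a 0 h) :
    ∃ K, 0 ≤ K ∧ ∀ r : ℝ, 0 ≤ r → r < 1 → ∀ φ : ℝ,
      ‖cauchyTransform h (r * exp (φ * I)) + cauchyTransform (fun θ => h (-θ)) (r * exp (-(φ * I))) -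
        cauchyTransform (fun θ => h (-θ)) 0 - h φ‖ ≤ K * (1 - r) ^ a := by
  have hc := hh.continuous ha ha1.le
  obtain ⟨hp, C, hC, hCh⟩ := hh
  have hpi := Real.pi_pos
  have h1a : 0 < 1 - a := by linarith
  refine ⟨(2 * Real.pi)⁻¹ * (C * 2 * (2 * Real.pi) ^ 2 * (2 / (1 - a))), by positivity,
    fun r hr0 hr φ => ?_⟩
  have hz : ‖(r * exp (φ * I) : ℂ)‖ < 1 :=
    mem_disk.1 (smul_mem_disk hr0 hr (norm_exp_ofReal_mul_I φ).le)
  have hz' : ‖(r * exp (-(φ * I)) : ℂ)‖ < 1 := by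
    have := mem_disk.1 (smul_mem_disk hr0 hr (norm_exp_ofReal_mul_I (-φ)).le)
    simpa using this
  have hP : Continuous fun θ : ℝ =>
      (((1 - r ^ 2) / ‖exp (θ * I) - r * exp (φ * I)‖ ^ 2 : ℝ) : ℂ) := by
    refine continuous_ofReal.comp (Continuous.div (by fun_prop) (by fun_prop) fun θ => ?_)
    exact pow_ne_zero _ (norm_ne_zero_iff.2 (exp_mul_I_sub_ne hz θ))
  -- The same formula with `h = 1` computes the mass of the Poisson kernel.
  have e1 := cauchyTransform_add_reflect (h := fun _ => 1) continuous_const (fun _ => rfl) hr0 hr φ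
  rw [cauchyTransform_one hz, cauchyTransform_one hz', cauchyTransform_one (by simp)] at e1
  have e2 : h φ = (2 * Real.pi : ℂ)⁻¹ * ∫ θ in (0 : ℝ)..2 * Real.pi,
        h φ * ((1 - r ^ 2) / ‖exp (θ * I) - r * exp (φ * I)‖ ^ 2 : ℝ) := by
    rw [intervalIntegral.integral_const_mul]
    simp only [one_mul] at e1
    linear_combination h φ * e1
  have e3 : Function.Periodic (fun θ : ℝ => (h θ - h φ) *
      (((1 - r ^ 2) / ‖exp (θ * I) - r * exp (φ * I)‖ ^ 2 : ℝ) : ℂ)) (2 * Real.pi) := fun θ => by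
    have := exp_mul_I_periodic θ
    simp only at this
    simp only [hp θ, this]
  rw [cauchyTransform_add_reflect hc hp hr0 hr]
  rw [e2]
  have i1 := hc.fun_mul hP
  have i2 := (continuous_const (y := h φ)).fun_mul hP
  rw [← mul_sub, ← intervalIntegral.integral_sub (i1.intervalIntegrable _ _)
    (i2.intervalIntegrable _ _)]
  simp_rw [← sub_mul]
  rw [integral_eq_integral_shift e3 φ, norm_mul]
  have h1r : 0 ≤ 1 - r := by linarith
  have := norm_integral_le_of_kernel hr0 hr ha ha1 (C := C * (2 * (1 - r))) (by positivity)
    (f := fun t => (h (φ + t) - h φ) *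
      (((1 - r ^ 2) / ‖exp ((φ + t : ℝ) * I) - r * exp (φ * I)‖ ^ 2 : ℝ) : ℂ)) fun t ht => by
    have h1 := hCh (φ + t) φ
    rw [add_sub_cancel_left] at h1
    have h2 : exp ((φ + t : ℝ) * I) - r * exp (φ * I) = exp (φ * I) * (exp (t * I) - r) := by
      push_cast
      rw [add_mul, exp_add]; ring
    rw [h2, norm_mul, norm_mul, norm_real, norm_exp_ofReal_mul_I, one_mul,
      Real.norm_of_nonneg (div_nonneg (by nlinarith) (by positivity)), ← mul_div_assoc]
    gcongr ?_ / _
    calc _ ≤ (C * |t| ^ a) * (2 * (1 - r)) := by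
          gcongr
          · nlinarith
          · nlinarith
      _ = _ := by ring
  have h3 : ‖(2 * Real.pi : ℂ)⁻¹‖ = (2 * Real.pi)⁻¹ := by
    rw [norm_inv, norm_mul, norm_real, Real.norm_of_nonneg hpi.le]; simp
  have h4 : (1 - r) ^ a = (1 - r) ^ (a - 1) * (1 - r) := by
    rw [← Real.rpow_add_one (by linarith), sub_add_cancel]
  rw [h3, h4]
  calc _ ≤ (2 * Real.pi)⁻¹ *
        (C * (2 * (1 - r)) * (2 * Real.pi) ^ 2 * (2 * (1 - r) ^ (a - 1) / (1 - a))) := by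
        gcongr
    _ = _ := by ring

/-- Plemelj decomposition on the circle. -/
lemma cauchyExt_add_reflect {a : ℝ} (ha : 0 < a) (ha1 : a < 1) {h : ℝ → ℂ}
    (hh : PerHolder a 0 h) (φ : ℝ) :
    cauchyExt h (exp (φ * I)) + cauchyExt (fun θ => h (-θ)) (exp (-(φ * I))) -
      cauchyExt (fun θ => h (-θ)) 0 = h φ := by
  have hh' := hh.comp_neg ha.le ha1.le
  obtain ⟨K, hK, hb⟩ := norm_poisson_sub_le ha ha1 hh
  have hn := (norm_exp_ofReal_mul_I φ).le
  have hn' : ‖exp (-(φ * I))‖ ≤ 1 := by simpa using (norm_exp_ofReal_mul_I (-φ)).le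
  have t1 := ((tendsto_radial (continuousOn_cauchyExt ha ha1 hh) hn).add
    (tendsto_radial (continuousOn_cauchyExt ha ha1 hh') hn')).sub_const
      (cauchyExt (fun θ => h (-θ)) 0)
  refine tendsto_nhds_unique t1 ?_
  rw [tendsto_iff_norm_sub_tendsto_zero]
  have h2 : Tendsto (fun r : ℝ => K * (1 - r) ^ a) (𝓝[<] 1) (𝓝 0) := by
    have : Continuous fun r : ℝ => K * (1 - r) ^ a :=
      continuous_const.mul (Continuous.rpow_const (by fun_prop) fun _ => Or.inr ha.le)
    simpa [Real.zero_rpow ha.ne'] using (this.tendsto 1).mono_left nhdsWithin_le_nhds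
  refine squeeze_zero' (.of_forall fun _ => norm_nonneg _) ?_ h2
  filter_upwards [Ioo_mem_nhdsLT (show (0 : ℝ) < 1 by norm_num)] with r hr
  rw [cauchyExt_eq (hh.continuous ha ha1.le) (smul_mem_disk hr.1.le hr.2 hn),
    cauchyExt_eq (hh'.continuous ha ha1.le) (smul_mem_disk hr.1.le hr.2 hn'),
    cauchyExt_eq (hh'.continuous ha ha1.le) (mem_disk.2 (by simp))]
  exact hb r hr.1.le hr.2 φ

end SLLoop

/-! ### Bézout identities in the disc algebra. -/

namespace SLLoop

open Filter

/-- Functions in the disc algebra are uniform limits of polynomials. -/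
lemma exists_polynomial_near {f : ℂ → ℂ} (hf : DiffContOnCl ℂ f disk) {ε : ℝ} (hε : 0 < ε) :
    ∃ P : Polynomial ℂ, ∀ z : ℂ, ‖z‖ ≤ 1 → ‖P.eval z - f z‖ < ε := by
  have hc := hf.continuousOn
  rw [closure_disk] at hc
  have hu := (isCompact_closedBall (0 : ℂ) 1).uniformContinuousOn_of_continuous hc
  obtain ⟨δ, hδ, hδf⟩ := Metric.uniformContinuousOn_iff.1 hu (ε / 2) (half_pos hε)
  -- The dilate `f (r z)` is within `ε / 2` of `f z` and is holomorphic on a larger disk, so its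
  -- Taylor sums converge uniformly. The radii satisfy `r < r' < R < 1`.
  obtain ⟨r, hr0, hr1, hrδ⟩ : ∃ r : ℝ, 0 < r ∧ r < 1 ∧ 1 - r < δ := by
    refine ⟨max (1 / 2) (1 - δ / 2), by positivity, ?_, ?_⟩
    · exact max_lt (by norm_num) (by linarith)
    · linarith [le_max_right (1 / 2) (1 - δ / 2)]
  obtain ⟨R, hR⟩ : ∃ R : NNReal, (R : ℝ) = (1 + (1 + r) / 2) / 2 := ⟨⟨_, by positivity⟩, rfl⟩
  have hR1 : (R : ℝ) < 1 := by linarith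
  obtain ⟨r', hr'⟩ : ∃ r' : NNReal, (r' : ℝ) = (1 + r) / 2 := ⟨⟨_, by positivity⟩, rfl⟩
  have hr'R : r' < R := by
    rw [← NNReal.coe_lt_coe]
    linarith
  have hd : DifferentiableOn ℂ f (Metric.closedBall 0 R) :=
    hf.differentiableOn.mono (Metric.closedBall_subset_ball hR1)
  have hps := hd.hasFPowerSeriesOnBall (lt_of_le_of_lt (zero_le) hr'R)
  have hunif := hps.tendstoUniformlyOn (r' := r') (by exact_mod_cast hr'R)
  obtain ⟨n, hn⟩ := ((Metric.tendstoUniformlyOn_iff.1 hunif) (ε / 2) (half_pos hε)).exists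
  refine ⟨∑ k ∈ Finset.range n, Polynomial.C ((cauchyPowerSeries f 0 R).coeff k * r ^ k) *
    Polynomial.X ^ k, fun z hz => ?_⟩
  have hrz : ‖(r : ℂ) * z‖ ≤ r := by
    rw [norm_mul, Complex.norm_real, Real.norm_of_nonneg hr0.le]
    exact mul_le_of_le_one_right hr0.le hz
  have h1 := hn (r * z) (by
    rw [mem_ball_zero_iff]
    refine hrz.trans_lt ?_
    linarith)
  rw [zero_add, dist_eq_norm, norm_sub_rev] at h1
  have h2 : Polynomial.eval z (∑ k ∈ Finset.range n,
      Polynomial.C ((cauchyPowerSeries f 0 R).coeff k * r ^ k) * Polynomial.X ^ k) =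
      (cauchyPowerSeries f 0 R).partialSum n (r * z) := by
    rw [Polynomial.eval_finsetSum, FormalMultilinearSeries.partialSum]
    refine Finset.sum_congr rfl fun k _ => ?_
    rw [FormalMultilinearSeries.apply_eq_pow_smul_coeff, smul_eq_mul]
    simp only [Polynomial.eval_mul, Polynomial.eval_C, Polynomial.eval_pow, Polynomial.eval_X]
    ring
  have h3 := hδf (r * z) (by rw [mem_closedBall_zero_iff]; linarith) z
    (by rwa [mem_closedBall_zero_iff]) (by
      rw [dist_eq_norm, show (r : ℂ) * z - z = -(((1 - r : ℝ) : ℂ) * z) by push_cast; ring,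
        norm_neg, norm_mul, Complex.norm_real, Real.norm_of_nonneg (by linarith)]
      refine lt_of_le_of_lt ?_ hrδ
      exact mul_le_of_le_one_right (by linarith) hz)
  rw [dist_eq_norm] at h3
  rw [h2]
  calc _ = ‖((cauchyPowerSeries f 0 R).partialSum n (r * z) - f (r * z)) + (f (r * z) - f z)‖ := by
        congr 1; ring
    _ ≤ _ := norm_add_le _ _
    _ < ε := by linarith

/-- In a commutative Banach algebra generated by `x`, two elements that are not killed by a common
character have a Bézout combination with polynomial coefficients that is close to `1`. -/
lemma exists_aeval_bezout_near {A : Type*} [NormedCommRing A] [NormedAlgebra ℂ A] [CompleteSpace A]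
    {x F G : A} (hx : DenseRange (Polynomial.aeval (R := ℂ) x))
    (hFG : ∀ χ : A →ₐ[ℂ] ℂ, Continuous χ → ¬ (χ F = 0 ∧ χ G = 0)) :
    ∃ P Q : Polynomial ℂ, ‖Polynomial.aeval x P * F + Polynomial.aeval x Q * G - 1‖ < 1 := by
  -- A proper ideal would lie in a maximal one, whose character kills both `F` and `G`.
  have htop : Ideal.span {F, G} = ⊤ := by
    by_contra hne
    obtain ⟨M, hM, hle⟩ := Ideal.exists_le_maximal _ hne
    exact hFG (WeakDual.CharacterSpace.equivAlgHom M.toCharacterSpace)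
      (map_continuous M.toCharacterSpace)
      ⟨M.toCharacterSpace_apply_eq_zero_of_mem (hle (Ideal.subset_span (by simp))),
        M.toCharacterSpace_apply_eq_zero_of_mem (hle (Ideal.subset_span (by simp)))⟩
  obtain ⟨U, V, hUV⟩ := Ideal.mem_span_pair.1 (htop ▸ Submodule.mem_top : (1 : A) ∈ _)
  -- An exact Bézout pair satisfies an open condition, so by density it can be moved to polynomials
  -- in `x`.
  have hopen : IsOpen {p : A × A | ‖p.1 * F + p.2 * G - 1‖ < 1} :=
    isOpen_lt (by fun_prop) continuous_const
  obtain ⟨⟨P, Q⟩, hPQ⟩ := (hx.prodMap hx).exists_mem_open hopen ⟨(U, V), by simp [hUV]⟩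
  exact ⟨P, Q, hPQ⟩

/-- Two functions of the disc algebra without common zeros on the closed disk have a Bézout
combination with polynomial coefficients that is uniformly close to `1`. -/
lemma exists_polynomial_bezout_near {f g : ℂ → ℂ} (hf : DiffContOnCl ℂ f disk)
    (hg : DiffContOnCl ℂ g disk) (hfg : ∀ z : ℂ, ‖z‖ ≤ 1 → ¬ (f z = 0 ∧ g z = 0)) :
    ∃ P Q : Polynomial ℂ, ∀ z : ℂ, ‖z‖ ≤ 1 → ‖f z * Q.eval z - g z * P.eval z - 1‖ < 1 := by
  set X := Metric.closedBall (0 : ℂ) 1 with hX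
  have hXmem : ∀ {z : ℂ}, z ∈ X ↔ ‖z‖ ≤ 1 := mem_closedBall_zero_iff
  have : CompactSpace X := isCompact_iff_compactSpace.1 (isCompact_closedBall _ _)
  have : Nonempty X := ⟨⟨0, hXmem.2 (by simp)⟩⟩
  -- The disc algebra as the uniform closure of the polynomials, so that it is generated by the
  -- coordinate function `x`.
  let A : Subalgebra ℂ C(X, ℂ) := (polynomialFunctions X).topologicalClosure
  have hAc : IsClosed (A : Set C(X, ℂ)) := Subalgebra.isClosed_topologicalClosure _
  have : CompleteSpace A := hAc.completeSpace_coe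
  have : NormOneClass A := ⟨norm_one (α := C(X, ℂ))⟩
  have hmem : ∀ {f : ℂ → ℂ}, DiffContOnCl ℂ f disk → ∃ F : A, ∀ z : X, (F : C(X, ℂ)) z = f z := by
    intro f hf
    have hc := hf.continuousOn
    rw [closure_disk] at hc
    refine ⟨⟨⟨X.domRestrict f, continuousOn_iff_continuous_domRestrict.1 hc⟩, ?_⟩, fun z => rfl⟩
    change _ ∈ closure ((polynomialFunctions X : Subalgebra ℂ C(X, ℂ)) : Set C(X, ℂ))
    rw [Metric.mem_closure_iff]
    intro ε hε
    obtain ⟨P, hP⟩ := exists_polynomial_near hf hε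
    refine ⟨P.toContinuousMapOn X, ?_, ?_⟩
    · rw [polynomialFunctions_coe]; exact ⟨P, rfl⟩
    · rw [ContinuousMap.dist_lt_iff hε]
      intro z
      rw [dist_comm, dist_eq_norm]
      exact hP z (hXmem.1 z.2)
  obtain ⟨F, hF⟩ := hmem hf
  obtain ⟨G, hG⟩ := hmem hg
  obtain ⟨x, hx⟩ := hmem (f := fun z => z) differentiable_id.diffContOnCl
  have hpoly : ∀ (P : Polynomial ℂ) (z : X),
      ((Polynomial.aeval x P : A) : C(X, ℂ)) z = P.eval (z : ℂ) := by
    intro P z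
    have h1 : ((Polynomial.aeval x P : A) : C(X, ℂ)) = Polynomial.aeval (x : C(X, ℂ)) P :=
      Polynomial.aeval_algHom_apply A.val x P |>.symm
    rw [h1, Polynomial.aeval_continuousMap_apply, hx]
  have hdense : DenseRange (Polynomial.aeval (R := ℂ) x) := by
    intro H
    rw [closure_subtype]
    refine closure_mono ?_ H.2
    intro u hu
    change u ∈ ((polynomialFunctions X : Subalgebra ℂ C(X, ℂ)) : Set C(X, ℂ)) at hu
    rw [polynomialFunctions_coe] at hu
    obtain ⟨P, rfl⟩ := hu
    exact ⟨Polynomial.aeval x P, ⟨P, rfl⟩, ContinuousMap.ext fun z => hpoly P z⟩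
  have hchar : ∀ χ : A →ₐ[ℂ] ℂ, Continuous χ → ¬ (χ F = 0 ∧ χ G = 0) := by
    rintro χ hχ ⟨hχF, hχG⟩
    have hl1 : ‖χ x‖ ≤ 1 := by
      refine (AlgHom.norm_apply_le_self χ _).trans ?_
      change ‖(x : C(X, ℂ))‖ ≤ 1
      rw [ContinuousMap.norm_le _ zero_le_one]
      intro z
      rw [hx]
      exact hXmem.1 z.2
    -- A continuous character is determined by its value at `x`, a point of the closed disk; it is
    -- evaluation there.
    have heval : ⇑χ = fun H : A => (H : C(X, ℂ)) ⟨χ x, hXmem.2 hl1⟩ := by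
      refine hdense.equalizer hχ
        ((continuous_eval_const _).comp continuous_subtype_val) (funext fun P => ?_)
      simp only [Function.comp_apply]
      rw [hpoly, ← Polynomial.aeval_algHom_apply, Polynomial.coe_aeval_eq_eval]
    rw [heval] at hχF hχG
    exact hfg _ hl1 ⟨(hF _).symm.trans hχF, (hG _).symm.trans hχG⟩
  obtain ⟨P, Q, hPQ⟩ := exists_aeval_bezout_near hdense hchar
  refine ⟨-Q, P, fun z hz => ?_⟩
  have h1 := (ContinuousMap.norm_coe_le_norm (Polynomial.aeval x P * F + Polynomial.aeval x Q * G - 1 :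
    A).1 ⟨z, hXmem.2 hz⟩).trans_lt hPQ
  have h2 : (Polynomial.aeval x P * F + Polynomial.aeval x Q * G - 1 : A).1 ⟨z, hXmem.2 hz⟩ =
      P.eval z * f z + Q.eval z * g z - 1 := by
    change (Polynomial.aeval x P).1 _ * F.1 _ + (Polynomial.aeval x Q).1 _ * G.1 _ - 1 = _
    rw [hpoly, hpoly, hF, hG]
  rw [h2] at h1
  rw [Polynomial.eval_neg]
  rwa [show f z * P.eval z - g z * -Q.eval z - 1 = P.eval z * f z + Q.eval z * g z - 1 by ring]

end SLLoop

/-! ### `C^s` functions on the disk and the exterior, and the decomposition of a row. -/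

namespace SLLoop

open Filter

section

variable {s : ℝ} {φ ψ : Circle → ℂ} {f g : ℂ → ℂ}

lemma fract_lt_one (s : ℝ) : s - ⌊s⌋₊ < 1 := by linarith [Nat.lt_floor_add_one s]

lemma isHolderCs_const (hs : 0 < s) (hs_int : ∀ n : ℤ, s ≠ n) (c : ℂ) :
    IsHolderCs s fun _ => c :=
  (isHolderCs_iff hs hs_int _).2 (.const c)

lemma IsHolderCs.add (hs : 0 < s) (hs_int : ∀ n : ℤ, s ≠ n) (hφ : IsHolderCs s φ)
    (hψ : IsHolderCs s ψ) : IsHolderCs s fun z => φ z + ψ z := by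
  rw [isHolderCs_iff hs hs_int] at *
  exact hφ.add hψ

lemma IsHolderCs.mul (hs : 0 < s) (hs_int : ∀ n : ℤ, s ≠ n) (hφ : IsHolderCs s φ)
    (hψ : IsHolderCs s ψ) : IsHolderCs s fun z => φ z * ψ z := by
  rw [isHolderCs_iff hs hs_int] at *
  exact hφ.mul (fract_pos hs hs_int).le (fract_lt_one s).le hψ

lemma IsHolderCs.neg (hs : 0 < s) (hs_int : ∀ n : ℤ, s ≠ n) (hφ : IsHolderCs s φ) :
    IsHolderCs s fun z => -φ z := by
  simpa using (isHolderCs_const hs hs_int (-1)).mul hs hs_int hφ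

lemma IsHolderCs.sub (hs : 0 < s) (hs_int : ∀ n : ℤ, s ≠ n) (hφ : IsHolderCs s φ)
    (hψ : IsHolderCs s ψ) : IsHolderCs s fun z => φ z - ψ z := by
  simpa [sub_eq_add_neg] using hφ.add hs hs_int (hψ.neg hs hs_int)

lemma IsHolderCs.inv (hs : 0 < s) (hs_int : ∀ n : ℤ, s ≠ n) (hφ : IsHolderCs s φ)
    (h0 : ∀ z, φ z ≠ 0) : IsHolderCs s fun z => (φ z)⁻¹ := by
  rw [isHolderCs_iff hs hs_int] at *
  exact PerHolder.inv (fract_pos hs hs_int) (fract_lt_one s).le hφ fun θ => h0 _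

lemma isHolderCs_coe (hs : 0 < s) (hs_int : ∀ n : ℤ, s ≠ n) :
    IsHolderCs s fun z => (z : ℂ) := by
  rw [isHolderCs_iff hs hs_int]
  refine .of_smooth (fract_pos hs hs_int).le (fract_lt_one s).le ?_ (periodic_circle_exp _)
  simp only [Circle.coe_exp]
  exact Complex.contDiff_exp.comp (Complex.ofRealCLM.contDiff.mul contDiff_const)

lemma diskCs_const (hs : 0 < s) (hs_int : ∀ n : ℤ, s ≠ n) (c : ℂ) : DiskCs s fun _ => c :=
  ⟨diffContOnCl_const, isHolderCs_const hs hs_int c⟩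

lemma exteriorCs_const (hs : 0 < s) (hs_int : ∀ n : ℤ, s ≠ n) (c : ℂ) :
    ExteriorCs s (fun _ => c) c :=
  ⟨diffContOnCl_const, tendsto_const_nhds, isHolderCs_const hs hs_int c⟩

lemma ExteriorCs.add_const (hs : 0 < s) (hs_int : ∀ n : ℤ, s ≠ n) {c : ℂ} (hf : ExteriorCs s f c)
    (d : ℂ) : ExteriorCs s (fun z => f z + d) (c + d) :=
  ⟨hf.1.add diffContOnCl_const, hf.2.1.add_const d,
    hf.2.2.add hs hs_int (isHolderCs_const hs hs_int d)⟩

lemma DiskCs.add (hs : 0 < s) (hs_int : ∀ n : ℤ, s ≠ n) (hf : DiskCs s f) (hg : DiskCs s g) :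
    DiskCs s fun z => f z + g z :=
  ⟨hf.1.add hg.1, hf.2.add hs hs_int hg.2⟩

lemma DiskCs.sub (hs : 0 < s) (hs_int : ∀ n : ℤ, s ≠ n) (hf : DiskCs s f) (hg : DiskCs s g) :
    DiskCs s fun z => f z - g z :=
  ⟨hf.1.sub hg.1, hf.2.sub hs hs_int hg.2⟩

lemma DiskCs.mul (hs : 0 < s) (hs_int : ∀ n : ℤ, s ≠ n) (hf : DiskCs s f) (hg : DiskCs s g) :
    DiskCs s fun z => f z * g z :=
  ⟨⟨hf.1.differentiableOn.mul hg.1.differentiableOn, hf.1.continuousOn.mul hg.1.continuousOn⟩,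
    hf.2.mul hs hs_int hg.2⟩

lemma DiskCs.const_mul (hs : 0 < s) (hs_int : ∀ n : ℤ, s ≠ n) (c : ℂ) (hf : DiskCs s f) :
    DiskCs s fun z => c * f z :=
  (diskCs_const hs hs_int c).mul hs hs_int hf

lemma DiskCs.inv (hs : 0 < s) (hs_int : ∀ n : ℤ, s ≠ n) (hf : DiskCs s f)
    (h0 : ∀ z : ℂ, ‖z‖ ≤ 1 → f z ≠ 0) : DiskCs s fun z => (f z)⁻¹ :=
  ⟨hf.1.inv fun z hz => h0 z (by rwa [closure_disk, mem_closedBall_zero_iff] at hz),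
    hf.2.inv hs hs_int fun z => h0 z z.norm_coe.le⟩

lemma diskCs_polynomial (hs : 0 < s) (hs_int : ∀ n : ℤ, s ≠ n) (P : Polynomial ℂ) :
    DiskCs s fun z => P.eval z := by
  induction P using Polynomial.induction_on with
  | C c => simpa using diskCs_const hs hs_int c
  | add p q hp hq => simpa using hp.add hs hs_int hq
  | monomial n c h =>
    have := h.mul hs hs_int (g := fun z => z) ⟨differentiable_id.diffContOnCl,
      isHolderCs_coe hs hs_int⟩
    simpa [pow_succ, mul_assoc] using this

/-- Bézout identity for `C^s` functions on the disk without common zeros. -/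
lemma exists_bezout (hs : 0 < s) (hs_int : ∀ n : ℤ, s ≠ n) (hf : DiskCs s f) (hg : DiskCs s g)
    (hfg : ∀ z : ℂ, ‖z‖ ≤ 1 → ¬ (f z = 0 ∧ g z = 0)) :
    ∃ p q : ℂ → ℂ, DiskCs s p ∧ DiskCs s q ∧ ∀ z : ℂ, ‖z‖ ≤ 1 → f z * q z - g z * p z = 1 := by
  -- Polynomial coefficients are what makes the solution `C^s`: the combination differs from `1` by
  -- less than `1`, so it has a `C^s` inverse.
  obtain ⟨P, Q, hPQ⟩ := exists_polynomial_bezout_near hf.1 hg.1 hfg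
  have hP := diskCs_polynomial hs hs_int P
  have hQ := diskCs_polynomial hs hs_int Q
  have hne : ∀ z : ℂ, ‖z‖ ≤ 1 → f z * Q.eval z - g z * P.eval z ≠ 0 := fun z hz h => by
    have := hPQ z hz
    rw [h, zero_sub, norm_neg, norm_one] at this
    exact lt_irrefl _ this
  have he := ((hf.mul hs hs_int hQ).sub hs hs_int (hg.mul hs hs_int hP)).inv hs hs_int hne
  refine ⟨_, _, hP.mul hs hs_int he, hQ.mul hs hs_int he, fun z hz => ?_⟩
  have := hne z hz
  field_simp

lemma closure_exterior : closure exterior = {z : ℂ | 1 ≤ ‖z‖} := by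
  have : exterior = (Metric.closedBall (0 : ℂ) 1)ᶜ := by ext; simp [exterior]
  rw [this, closure_compl, interior_closedBall _ one_ne_zero]
  ext; simp

lemma inv_mem_disk {z : ℂ} (hz : z ∈ exterior) : z⁻¹ ∈ disk := by
  rw [mem_disk, norm_inv]
  exact inv_lt_one_of_one_lt₀ hz

lemma diffContOnCl_comp_inv (hf : DiffContOnCl ℂ f disk) :
    DiffContOnCl ℂ (fun z => f z⁻¹) exterior := by
  constructor
  · refine hf.differentiableOn.comp (fun z hz => ?_) fun z hz => inv_mem_disk hz
    exact (differentiableAt_inv (norm_pos_iff.1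
      (one_pos.trans hz))).differentiableWithinAt
  · refine hf.continuousOn.comp (fun z hz => ?_) fun z hz => ?_
    · rw [closure_exterior] at hz
      exact (continuousAt_inv₀ (norm_pos_iff.1 (one_pos.trans_le hz))).continuousWithinAt
    · rw [closure_exterior] at hz
      rw [closure_disk, mem_closedBall_zero_iff, norm_inv]
      exact inv_le_one_of_one_le₀ hz

lemma tendsto_comp_inv (hf : DiffContOnCl ℂ f disk) :
    Tendsto (fun z => f z⁻¹) (Bornology.cobounded ℂ) (𝓝 (f 0)) := by
  have h0 : disk ∈ 𝓝 (0 : ℂ) := Metric.ball_mem_nhds _ one_pos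
  exact (hf.differentiableOn.differentiableAt h0).continuousAt.tendsto.comp
    Filter.tendsto_inv₀_cobounded

/-- A `C^s` function on the circle is the sum of the boundary values of a holomorphic function on the
disk and of one on the exterior domain that vanishes at infinity. -/
lemma exists_disk_add_exterior (hs : 0 < s) (hs_int : ∀ n : ℤ, s ≠ n) (hφ : IsHolderCs s φ) :
    ∃ F H : ℂ → ℂ, DiskCs s F ∧ ExteriorCs s H 0 ∧
      (∃ x : ℕ → ℂ, ∀ z ∈ exterior, HasSum (fun j : ℕ => x (j + 1) * (z ^ (j + 1))⁻¹) (H z)) ∧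
      ∀ z : Circle, φ z = F z + H z := by
  have ha := fract_pos hs hs_int
  have ha1 := fract_lt_one s
  rw [isHolderCs_iff hs hs_int] at hφ
  set h : ℝ → ℂ := fun θ => φ (Circle.exp θ) with hh
  have hφ' := hφ.comp_neg ha.le ha1.le
  have hF := diffContOnCl_cauchyExt ha ha1 (hφ.to_zero ha.le ha1.le)
  set G := cauchyExt fun θ => h (-θ) with hGdef
  have hG : DiffContOnCl ℂ G disk := diffContOnCl_cauchyExt ha ha1 (hφ'.to_zero ha.le ha1.le)
  -- Subtracting `G 0` makes the exterior part vanish at infinity and is exactly the constant in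
  -- `cauchyExt_add_reflect`.
  refine ⟨cauchyExt h, fun z => G z⁻¹ - G 0, ⟨hF, ?_⟩, ⟨?_, ?_, ?_⟩, ?_, ?_⟩
  · rw [isHolderCs_iff hs hs_int]
    simpa only [Circle.coe_exp] using perHolder_cauchyExt ha ha1 hφ
  · exact (diffContOnCl_comp_inv hG).sub diffContOnCl_const
  · simpa using (tendsto_comp_inv hG).sub_const (G 0)
  · rw [isHolderCs_iff hs hs_int]
    have := ((perHolder_cauchyExt ha ha1 hφ').comp_neg ha.le ha1.le).sub ha.le ha1.le
      (.const (G 0))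
    simpa only [Circle.coe_exp, Complex.ofReal_neg, neg_mul, Complex.exp_neg] using this
  -- Taylor expansion of `G` at `0`, evaluated at `1/z`; the removed constant is the term of index
  -- `0`.
  · refine ⟨fun n => (n.factorial : ℂ)⁻¹ * iteratedDeriv n G 0, fun z hz => ?_⟩
    have h1 := Complex.hasSum_taylorSeries_on_ball (r := 1) hG.differentiableOn (inv_mem_disk hz)
    have h2 := (hasSum_nat_add_iff' 1).2 h1
    simp only [Finset.range_one, Finset.sum_singleton, Nat.factorial_zero, Nat.cast_one, inv_one,
      pow_zero, iteratedDeriv_zero, one_smul] at h2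
    refine h2.congr_fun fun j => ?_
    simp only [smul_eq_mul, sub_zero, inv_pow]
    ring
  · intro z
    obtain ⟨θ, rfl⟩ := Circle.exp_surjective z
    have := cauchyExt_add_reflect ha ha1 (hφ.to_zero ha.le ha1.le) θ
    rw [Complex.exp_neg] at this
    change h θ = _
    rw [← this, Circle.coe_exp]
    ring

/-- A row with `C^s` entries that completes `(f, g)` to a matrix of determinant one differs from a
row of boundary values of functions on the disk, with the same property, by a multiple of `(f, g)`,
where the factor extends to the exterior domain and vanishes at infinity. -/
lemma exists_row_decomposition (hs : 0 < s) (hs_int : ∀ n : ℤ, s ≠ n) (hf : DiskCs s f)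
    (hg : DiskCs s g) (hfg : ∀ z ∈ disk, ¬ (f z = 0 ∧ g z = 0)) (hφ : IsHolderCs s φ)
    (hψ : IsHolderCs s ψ) (hdet : ∀ z : Circle, f z * ψ z - g z * φ z = 1) :
    ∃ p q H : ℂ → ℂ, DiskCs s p ∧ DiskCs s q ∧ ExteriorCs s H 0 ∧
      (∃ x : ℕ → ℂ, ∀ z ∈ exterior, HasSum (fun j : ℕ => x (j + 1) * (z ^ (j + 1))⁻¹) (H z)) ∧
      (∀ z : ℂ, ‖z‖ ≤ 1 → f z * q z - g z * p z = 1) ∧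
      ∀ z : Circle, φ z = p z + H z * f z ∧ ψ z = q z + H z * g z := by
  obtain ⟨p, q, hp, hq, hpq⟩ := exists_bezout hs hs_int hf hg fun z hz h => by
    rcases hz.lt_or_eq with hz | hz
    · exact hfg z (mem_disk.2 hz) h
    · have := hdet ⟨z, mem_sphere_zero_iff_norm.2 hz⟩
      simp [h.1, h.2] at this
  -- The split function is `φ q - ψ p`, the multiplier of `(f, g)` separating the two completions.
  obtain ⟨F, H, hF, hH, hx, hsum⟩ := exists_disk_add_exterior hs hs_int
    ((hφ.mul hs hs_int hq.2).sub hs hs_int (hψ.mul hs hs_int hp.2))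
  refine ⟨fun z => p z + F z * f z, fun z => q z + F z * g z, H,
    hp.add hs hs_int (hF.mul hs hs_int hf), hq.add hs hs_int (hF.mul hs hs_int hg), hH, hx,
    fun z hz => by linear_combination hpq z hz, fun z => ?_⟩
  have h1 := hpq z z.norm_coe.le
  have h2 := hdet z
  have h3 := hsum z
  constructor
  · linear_combination f z * h3 + p z * h2 - φ z * h1
  · linear_combination g z * h3 + q z * h2 - ψ z * h1

/-- The shape of `l` is given only on the exterior domain, whereas the factorization holds on the
circle. -/
lemma eq_const_on_circle {c : ℂ} (hf : ContinuousOn f (closure exterior))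
    (h : ∀ z ∈ exterior, f z = c) (z : Circle) : f z = c := by
  have : Set.EqOn f (fun _ => c) (closure exterior) :=
    Set.EqOn.of_subset_closure h hf continuousOn_const subset_closure subset_rfl
  exact this (by rw [closure_exterior]; exact z.norm_coe.ge)

end

end SLLoop

/-! ### The two equivalences. -/

namespace SLLoop

section

variable {s : ℝ} {g : Circle → Matrix.SpecialLinearGroup (Fin 2) ℂ}

lemma row_det (g : Circle → Matrix.SpecialLinearGroup (Fin 2) ℂ) (z : Circle) :
    (g z).1 0 0 * (g z).1 1 1 - (g z).1 0 1 * (g z).1 1 0 = 1 := by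
  rw [← Matrix.det_fin_two]; exact (g z).2

lemma FirstRowCondition.firstFactorization (hs : 0 < s) (hs_int : ∀ n : ℤ, s ≠ n)
    (hg : IsCsLoop s g) (h : FirstRowCondition s g) : FirstFactorization s g := by
  obtain ⟨a, b, ha, hb, ha0, hab, hrow⟩ := h
  have hent : ∀ z, (g z).1 0 0 = a z ∧ (g z).1 0 1 = b z := fun z => by
    obtain ⟨c, d, h⟩ := hrow z
    rw [h]; simp
  obtain ⟨p, q, H, hp, hq, hH, ⟨x, hx⟩, hpq, hdec⟩ := exists_row_decomposition hs hs_int ha hb hab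
    (hg 1 0) (hg 1 1) fun z => by
      rw [← (hent z).1, ← (hent z).2]; exact row_det g z
  -- Chosen so that `p - k a` vanishes at `0`, as a unipotent upper triangular `u 0` requires. The
  -- constant moves into `l`, which is why this series has a term `j = 0`.
  set k := p 0 / a 0 with hk
  have hp' := hp.sub hs hs_int (ha.const_mul hs hs_int k)
  have hq' := hq.sub hs hs_int (hb.const_mul hs hs_int k)
  have hH' := hH.add_const hs hs_int k
  rw [zero_add] at hH'
  have h00 : a 0 * (q 0 - k * b 0) = 1 := by
    have h1 := hpq 0 (by simp)
    have h2 : k * a 0 = p 0 := div_mul_cancel₀ _ ha0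
    linear_combination h1 - b 0 * h2
  refine ⟨fun z => !![1, 0; H z + k, 1],
    fun z => !![(a 0)⁻¹ * a z, (a 0)⁻¹ * b z; a 0 * (p z - k * a z), a 0 * (q z - k * b z)], a 0,
    { lower := ⟨k, ?_⟩
      lower_det := fun z _ => by simp [Matrix.det_fin_two]
      diag_ne_zero := ha0
      upper := ?_
      upper_det := fun z hz => ?_
      upper_zero := ⟨(a 0)⁻¹ * b 0, ?_⟩
      factor := fun z => ?_ }, fun n => if n = 0 then k else x n, fun z hz => ⟨H z + k, ?_, rfl⟩⟩
  · intro i j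
    fin_cases i <;> fin_cases j
    · exact exteriorCs_const hs hs_int 1
    · exact exteriorCs_const hs hs_int 0
    · exact hH'
    · exact exteriorCs_const hs hs_int 1
  · intro i j
    fin_cases i <;> fin_cases j
    · exact ha.const_mul hs hs_int _
    · exact hb.const_mul hs hs_int _
    · exact hp'.const_mul hs hs_int _
    · exact hq'.const_mul hs hs_int _
  · have h1 := hpq z (mem_disk.1 hz).le
    rw [Matrix.det_fin_two]
    simp only [Matrix.of_apply, Matrix.cons_val', Matrix.cons_val_zero, Matrix.cons_val_one,
      Matrix.cons_val_fin_one]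
    field_simp
    linear_combination h1
  · have h2 : p 0 - k * a 0 = 0 := by rw [hk, div_mul_cancel₀ _ ha0, sub_self]
    simp only [h00, h2, mul_zero, inv_mul_cancel₀ ha0]
  · obtain ⟨h1, h2⟩ := hent z
    obtain ⟨h3, h4⟩ := hdec z
    ext i j
    fin_cases i <;> fin_cases j <;> simp [Matrix.mul_apply, Fin.sum_univ_two]
    · rw [h1]; field_simp
    · rw [h2]; field_simp
    · rw [h3]; field_simp; ring
    · rw [h4]; field_simp; ring
  · refine (hasSum_nat_add_iff' 1).1 ?_
    simpa using hx z hz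

/-- Because `c 0 = 0`, the lower left entry of `u 0` vanishes without any correction. So `H` is used
unchanged and its series starts at `j = 1`. -/
lemma SecondRowCondition.secondFactorization (hs : 0 < s) (hs_int : ∀ n : ℤ, s ≠ n)
    (hg : IsCsLoop s g) (h : SecondRowCondition s g) : SecondFactorization s g := by
  obtain ⟨c, d, hc, hd, hc0, hd0, hcd, hrow⟩ := h
  have hent : ∀ z, (g z).1 1 0 = c z ∧ (g z).1 1 1 = d z := fun z => by
    obtain ⟨a, b, h⟩ := hrow z
    rw [h]; simp
  -- Both rows enter with their columns swapped, which keeps the sign of the determinant although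
  -- the known row is now the lower one.
  obtain ⟨p, q, H, hp, hq, hH, ⟨x, hx⟩, hpq, hdec⟩ := exists_row_decomposition hs hs_int hd hc
    (fun z hz h => hcd z hz h.symm) (hg 0 1) (hg 0 0) fun z => by
      rw [← (hent z).1, ← (hent z).2]; exact (by ring : _ = _).trans (row_det g z)
  have h00 : d 0 * q 0 = 1 := by simpa [hc0] using hpq 0 (by simp)
  refine ⟨fun z => !![1, H z; 0, 1],
    fun z => !![d 0 * q z, d 0 * p z; (d 0)⁻¹ * c z, (d 0)⁻¹ * d z], (d 0)⁻¹,
    { lower := ⟨0, ?_⟩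
      lower_det := fun z _ => by simp [Matrix.det_fin_two]
      diag_ne_zero := inv_ne_zero hd0
      upper := ?_
      upper_det := fun z hz => ?_
      upper_zero := ⟨d 0 * p 0, ?_⟩
      factor := fun z => ?_ }, x, fun z hz => ⟨H z, hx z hz, rfl⟩⟩
  · intro i j
    fin_cases i <;> fin_cases j
    · exact exteriorCs_const hs hs_int 1
    · exact hH
    · exact exteriorCs_const hs hs_int 0
    · exact exteriorCs_const hs hs_int 1
  · intro i j
    fin_cases i <;> fin_cases j
    · exact hq.const_mul hs hs_int _
    · exact hp.const_mul hs hs_int _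
    · exact hc.const_mul hs hs_int _
    · exact hd.const_mul hs hs_int _
  · have h1 := hpq z (mem_disk.1 hz).le
    rw [Matrix.det_fin_two]
    simp only [Matrix.of_apply, Matrix.cons_val', Matrix.cons_val_zero, Matrix.cons_val_one,
      Matrix.cons_val_fin_one]
    field_simp
    linear_combination h1
  · simp only [h00, hc0, mul_zero, inv_mul_cancel₀ hd0]
  · obtain ⟨h1, h2⟩ := hent z
    obtain ⟨h3, h4⟩ := hdec z
    ext i j
    fin_cases i <;> fin_cases j <;> simp [Matrix.mul_apply, Fin.sum_univ_two]
    · rw [h4]; field_simp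
    · rw [h3]; field_simp
    · rw [h1]; field_simp
    · rw [h2]; field_simp

lemma FirstFactorization.firstRowCondition (hs : 0 < s) (hs_int : ∀ n : ℤ, s ≠ n)
    (h : FirstFactorization s g) : FirstRowCondition s g := by
  obtain ⟨l, u, a, hfac, y, hy⟩ := h
  obtain ⟨c, hl⟩ := hfac.lower
  obtain ⟨e, hu0⟩ := hfac.upper_zero
  have hl0 : ∀ z ∈ exterior, l z 0 0 = 1 ∧ l z 0 1 = 0 := fun z hz => by
    obtain ⟨t, -, ht⟩ := hy z hz
    rw [ht]; simp
  have l00 := eq_const_on_circle (hl 0 0).1.continuousOn fun z hz => (hl0 z hz).1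
  have l01 := eq_const_on_circle (hl 0 1).1.continuousOn fun z hz => (hl0 z hz).2
  refine ⟨fun z => a * u z 0 0, fun z => a * u z 0 1, (hfac.upper 0 0).const_mul hs hs_int a,
    (hfac.upper 0 1).const_mul hs hs_int a, ?_, ?_, fun z => ⟨(g z).1 1 0, (g z).1 1 1, ?_⟩⟩
  · simpa [hu0] using hfac.diag_ne_zero
  -- A common zero would annihilate a row of `u z`, against `det (u z) = 1`.
  · rintro z hz ⟨h1, h2⟩
    have hdet := hfac.upper_det z hz
    have h1' := (mul_eq_zero.1 h1).resolve_left hfac.diag_ne_zero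
    have h2' := (mul_eq_zero.1 h2).resolve_left hfac.diag_ne_zero
    rw [Matrix.det_fin_two, h1', h2'] at hdet
    simp at hdet
  · have hf := hfac.factor z
    ext i j
    fin_cases i <;> fin_cases j
    · simp [hf, Matrix.mul_apply, Fin.sum_univ_two, l00 z, l01 z]
    · simp [hf, Matrix.mul_apply, Fin.sum_univ_two, l00 z, l01 z]
    · rfl
    · rfl

lemma SecondFactorization.secondRowCondition (hs : 0 < s) (hs_int : ∀ n : ℤ, s ≠ n)
    (h : SecondFactorization s g) : SecondRowCondition s g := by
  obtain ⟨l, u, a, hfac, x, hx⟩ := h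
  obtain ⟨c, hl⟩ := hfac.lower
  obtain ⟨e, hu0⟩ := hfac.upper_zero
  have ha := inv_ne_zero hfac.diag_ne_zero
  have hl0 : ∀ z ∈ exterior, l z 1 0 = 0 ∧ l z 1 1 = 1 := fun z hz => by
    obtain ⟨t, -, ht⟩ := hx z hz
    rw [ht]; simp
  have l10 := eq_const_on_circle (hl 1 0).1.continuousOn fun z hz => (hl0 z hz).1
  have l11 := eq_const_on_circle (hl 1 1).1.continuousOn fun z hz => (hl0 z hz).2
  refine ⟨fun z => a⁻¹ * u z 1 0, fun z => a⁻¹ * u z 1 1, (hfac.upper 1 0).const_mul hs hs_int _,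
    (hfac.upper 1 1).const_mul hs hs_int _, ?_, ?_, ?_, fun z => ⟨(g z).1 0 0, (g z).1 0 1, ?_⟩⟩
  · simp [hu0]
  · simpa [hu0] using hfac.diag_ne_zero
  · rintro z hz ⟨h1, h2⟩
    have hdet := hfac.upper_det z hz
    have h1' := (mul_eq_zero.1 h1).resolve_left ha
    have h2' := (mul_eq_zero.1 h2).resolve_left ha
    rw [Matrix.det_fin_two, h1', h2'] at hdet
    simp at hdet
  · have hf := hfac.factor z
    ext i j
    fin_cases i <;> fin_cases j
    · rfl
    · rfl
    · simp [hf, Matrix.mul_apply, Fin.sum_univ_two, l10 z, l11 z]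
    · simp [hf, Matrix.mul_apply, Fin.sum_univ_two, l10 z, l11 z]

end

end SLLoop

theorem theorem2p2 (s : ℝ) (hs : 0 < s) (hs_int : ∀ n : ℤ, s ≠ (n : ℝ)) :
    (∀ g₁ : Circle → Matrix.SpecialLinearGroup (Fin 2) ℂ, SLLoop.IsCsLoop s g₁ →
      (SLLoop.FirstRowCondition s g₁ ↔ SLLoop.FirstFactorization s g₁)) ∧
    (∀ g₂ : Circle → Matrix.SpecialLinearGroup (Fin 2) ℂ, SLLoop.IsCsLoop s g₂ →
      (SLLoop.SecondRowCondition s g₂ ↔ SLLoop.SecondFactorization s g₂)) :=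
  ⟨fun _ hg => ⟨fun h => h.firstFactorization hs hs_int hg, fun h => h.firstRowCondition hs hs_int⟩,
    fun _ hg =>
      ⟨fun h => h.secondFactorization hs hs_int hg, fun h => h.secondRowCondition hs hs_int⟩⟩
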